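/- **Setting.** For a simplicial pair $(K,K_0)$ (a simplicial complex and a subcomplex), $|K-K_0|$ is the union of the open simplices of $K$ not in $K_0$. Let $M$ be a topological $m$-manifold without boundary (Hausdorff, locally Euclidean), triangulated by a simplicial pair $(K,K_0)$ through a homeomorphism $\phi:|K-K_0|\to M$; let $K^1,K^2$ be the first and second (barycentric) subdivisions of $K$. The open star $\mathrm{st}\,\sigma$ of a simplex $\sigma$ is the union of the open simplices having $\sigma$ as a face. For a triangulated space, a *basic open set associated to* $\sigma$ is an open set $U\subseteq\mathrm{st}\,\sigma$ that contains a point of the open simplex $\sigma$ about which it is star-shaped in barycentric coordinates; these sets include the open stars and form a basis of the topology. A *bisheaf* around $M$ is a sheaf $\overline F$ and a cosheaf $\underline F$ of abelian groups on $M$ with homomorphisms $F(U):\overline F(U)\to\underline F(U)$ for all non-empty connected open $U$, such that $\underline F(V\subseteq U)\circ F(V)\circ\overline F(V\subseteq U)=F(U)$ whenever $V\subseteq U$. It is *$K$-constructible* if $\overline F(V\subseteq U)$ and $\underline F(V\subseteq U)$ are isomorphisms whenever $V\subseteq U$ are basic open sets associated to the same simplex. An *episheaf* is a constructible sheaf whose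 restriction maps between basic open sets are surjective; a *monocosheaf* is a constructible cosheaf whose extension maps between basic open sets are injective. $\mathrm{Epi}(\overline F)$ is the largest sub-episheaf of $\overline F$, $\mathrm{Mono}(\underline F)$ is the smallest quotient of $\underline F$ that is a monocosheaf (the quotient by the smallest possible kernel), and $\mathrm{Iso}(F)$ is the bisheaf given by the compositions $\mathrm{Epi}(\overline F)\hookrightarrow\overline F\to\underline F\twoheadrightarrow\mathrm{Mono}(\underline F)$. On basic open sets $U$, the images of these compositions form a local system (all maps induced by inclusions $V\subseteq U$ are isomorphisms), the *persistent local system* $\mathrm{im}\,\mathrm{Iso}(F)$. An *étale open* is a local homeomorphism $a:A\to M$ from a Hausdorff space $A$; sheaves, cosheaves and stratifications are pulled back along it, so $(a^*F)(U)=F(a(U))$ for an open $U$ on which $a$ is injective and whose image is basic. It is *$K$-constructible* if there are a simplicial pair $(L,L_0)$, a homeomorphism $\chi:|L-L_0|\to A$ and a simplicial map $\psi:L\to K$ with $a\circ\chi=\phi\circ|\psi|$, such that every simplex of $L_0$ is a face of a simplex of $L-L_0$, and every $(m-1)$-simplex of $L_0$ is a face of exactly one $m$-simplex of $L-L_0$.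 The *shrinking* of $a$ (for such data) is the restriction $\dot a$ of $a$ to the open subset $\dot A=|L^2-\mathrm{cl}\,\mathrm{st}\,L_0^2|$ of $A$, where $\mathrm{cl}\,\mathrm{st}\,L_0^2$ consists of all faces of those simplices of $L^2$ that have a face in $L_0^2$; let $\mu:\dot A\to A$ be the inclusion. The *dilation* $\Sigma:K^2\to K^1$ is the simplicial map that sends the vertex $[\sigma_0\subsetneq\dots\subsetneq\sigma_n]$ of $K^2$ to the vertex $\sigma_0$ of $K^1$. For a $K$-constructible bisheaf $F$, $\Sigma^*F$ is the $K^2$-constructible bisheaf, on the part of $M$ that $|\Sigma|$ maps into $|K-K_0|$ (an open set containing $\dot a(\dot A)$, and all of $M$ if $K_0=\emptyset$), with $(\Sigma^*F)(U)=F(\mathrm{st}\,\Sigma(\tau))$ for a basic open set $U$ of $K^2$ associated to the simplex $\tau$ of $K^2$, for sheaf, cosheaf and map alike. **Proposition.** Let $F$ be a $K$-constructible bisheaf around $M$ and $a:A\to M$ a $K$-constructible étale open with shrinking $\dot a:\dot A\to M$ and inclusion $\mu:\dot A\to A$. Then the persistent local systems $\mathrm{im}\,\mu^*\mathrm{Iso}(a^*F)$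 (with $\mathrm{Iso}$ formed for the stratification of $A$ pulled back from $K$) and $\mathrm{im}\,\mathrm{Iso}(\dot a^*\Sigma^*F)$ (with $\mathrm{Iso}$ formed for the stratification of $\dot A$ pulled back from $K^2$) are isomorphic as local systems over $\dot A$. -/

import Mathlib

open CategoryTheory Opposite TopologicalSpace
universe u u' v v' w
namespace PersistentSheaf

section Simplicial
variable {V : Type v}

/-- The open simplex on the vertices `s`, in barycentric coordinates. -/
def openSimplex (s : Finset V) : Set (V → ℝ) :=
  {x | (∀ v ∈ s, 0 < x v) ∧ (∀ v ∉ s, x v = 0) ∧ ∑ v ∈ s, x v = 1}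

/-- The first subdivision of a simplicial complex: its simplices are the non-empty chains of
simplices. -/
def sd (K : PreAbstractSimplicialComplex V) : PreAbstractSimplicialComplex (Finset V) where
  faces := {c | c.Nonempty ∧ (∀ σ ∈ c, σ ∈ K) ∧ IsChain (· ⊆ ·) (c : Set (Finset V))}
  isRelLowerSet_faces := by
    rintro c ⟨h1, h2, h3⟩
    exact ⟨h1, fun d hd hne => ⟨hne, fun σ hσ => h2 σ (hd hσ), h3.mono (Finset.coe_subset.2 hd)⟩⟩

/-- The affine map `|sd K| → |K|` that sends the vertex `σ` to the barycenter of `σ`. -/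
noncomputable def sdMap (f : Finset V → ℝ) : V → ℝ :=
  fun v => ∑ᶠ (σ : Finset V) (_ : v ∈ σ), f σ / (σ.card : ℝ)

/-- The open simplex `c` of the first subdivision, as a subset of `|K|`. -/
def cell₁ (c : Finset (Finset V)) : Set (V → ℝ) := sdMap '' openSimplex c

/-- The open simplex `C` of the second subdivision, as a subset of `|K|`. -/
def cell₂ (C : Finset (Finset (Finset V))) : Set (V → ℝ) := sdMap '' (sdMap '' openSimplex C)

/-- The closed star `cl st J₀` of a subcomplex `J₀` in `J`: all faces of simplices that have a
face in `J₀`. -/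
def closedStar (J J₀ : PreAbstractSimplicialComplex V) : Set (Finset V) :=
  {s | s ∈ J ∧ ∃ t ∈ J, s ⊆ t ∧ ∃ r ∈ J₀, r ⊆ t}

open Classical in
/-- The dilation on vertices: a non-empty chain `σ₀ ⊊ ⋯ ⊊ σₙ` is sent to its least member `σ₀`. -/
noncomputable def dilationVertex (c : Finset (Finset V)) : Finset V :=
  if h : c.Nonempty then c.inf' h id else ∅

open Classical in
/-- The dilation `Σ`, a simplicial map from the second to the first subdivision. -/
noncomputable def dilation (C : Finset (Finset (Finset V))) : Finset (Finset V) :=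
  C.image dilationVertex

theorem mem_nonempty {K : PreAbstractSimplicialComplex V} {s : Finset V} (h : s ∈ K) :
    s.Nonempty := (K.isRelLowerSet_faces h).1

open Classical in
theorem dilationVertex_mem {c : Finset (Finset V)} (hne : c.Nonempty)
    (hc : IsChain (· ⊆ ·) (c : Set (Finset V))) :
    dilationVertex c ∈ c ∧ ∀ σ ∈ c, dilationVertex c ⊆ σ := by
  have hle : ∀ σ ∈ c, dilationVertex c ⊆ σ := by
    intro σ hσ
    rw [dilationVertex, dif_pos hne]
    exact Finset.inf'_le id hσ
  refine ⟨?_, hle⟩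
  rw [dilationVertex, dif_pos hne]
  refine Finset.inf'_mem (c : Set (Finset V)) ?_ c hne id (fun i hi => hi)
  intro x hx y hy
  rcases hc.total hx hy with h | h
  · rwa [inf_eq_left.2 h]
  · rwa [inf_eq_right.2 h]

theorem dilation_mem {K : PreAbstractSimplicialComplex V} {C : Finset (Finset (Finset V))}
    (hC : C ∈ sd (sd K)) : dilation C ∈ sd K := by
  classical
  obtain ⟨hne, hsub, hch⟩ := hC
  refine ⟨hne.image _, ?_, ?_⟩
  · intro σ hσ
    obtain ⟨c, hc, rfl⟩ := Finset.mem_image.1 hσ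
    obtain ⟨h1, h2, h3⟩ := hsub c hc
    exact h2 _ (dilationVertex_mem h1 h3).1
  · intro σ hσ τ hτ _
    obtain ⟨c, hc, rfl⟩ := Finset.mem_image.1 (Finset.mem_coe.1 hσ)
    obtain ⟨d, hd, rfl⟩ := Finset.mem_image.1 (Finset.mem_coe.1 hτ)
    obtain ⟨c1, -, c3⟩ := hsub c hc
    obtain ⟨d1, -, d3⟩ := hsub d hd
    rcases hch.total hc hd with h | h
    · exact Or.inr ((dilationVertex_mem d1 d3).2 _ (h (dilationVertex_mem c1 c3).1))
    · exact Or.inl ((dilationVertex_mem c1 c3).2 _ (h (dilationVertex_mem d1 d3).1))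

open Classical in
theorem sdMap_apply {c : Finset (Finset V)} {f : Finset V → ℝ} (hf : ∀ σ ∉ c, f σ = 0) (v : V) :
    sdMap f v = ∑ σ ∈ c, if v ∈ σ then f σ / (σ.card : ℝ) else 0 := by
  rw [sdMap]
  have h : ∀ σ : Finset V, (∑ᶠ (_ : v ∈ σ), f σ / (σ.card : ℝ)) =
      if v ∈ σ then f σ / (σ.card : ℝ) else 0 := fun σ => finsum_eq_if
  simp_rw [h]
  refine finsum_eq_sum_of_support_subset _ fun σ hσ => ?_
  by_contra hc
  apply hσ
  simp [hf σ hc]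

theorem exists_top {K : PreAbstractSimplicialComplex V} {c : Finset (Finset V)} (hc : c ∈ sd K) :
    ∃ σ ∈ c, ∀ τ ∈ c, τ ⊆ σ := by
  classical
  refine ⟨c.sup' hc.1 id, ?_, fun τ hτ => Finset.le_sup' id hτ⟩
  refine Finset.sup'_mem (c : Set (Finset V)) ?_ c hc.1 id (fun i hi => hi)
  intro x hx y hy
  rcases hc.2.2.total hx hy with h | h
  · rwa [sup_eq_right.2 h]
  · rwa [sup_eq_left.2 h]

theorem sdMap_mem_openSimplex {K : PreAbstractSimplicialComplex V} {c : Finset (Finset V)}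
    (hc : c ∈ sd K) {σ : Finset V} (hσ : σ ∈ c) (htop : ∀ τ ∈ c, τ ⊆ σ) {f : Finset V → ℝ}
    (hf : f ∈ openSimplex c) : sdMap f ∈ openSimplex σ := by
  classical
  obtain ⟨hpos, hzero, hsum⟩ := hf
  have hcard : ∀ τ ∈ c, 0 < (τ.card : ℝ) := fun τ hτ => by
    exact_mod_cast Finset.card_pos.2 (mem_nonempty (hc.2.1 τ hτ))
  refine ⟨fun v hv => ?_, fun v hv => ?_, ?_⟩
  · rw [sdMap_apply hzero]
    refine Finset.sum_pos' (fun τ hτ => ?_) ⟨σ, hσ, ?_⟩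
    · split_ifs
      · exact (div_pos (hpos τ hτ) (hcard τ hτ)).le
      · exact le_rfl
    · rw [if_pos hv]
      exact div_pos (hpos σ hσ) (hcard σ hσ)
  · rw [sdMap_apply hzero]
    exact Finset.sum_eq_zero fun τ hτ => if_neg fun h => hv (htop τ hτ h)
  · simp_rw [sdMap_apply hzero]
    rw [Finset.sum_comm, ← hsum]
    refine Finset.sum_congr rfl fun τ hτ => ?_
    rw [← Finset.sum_filter, Finset.sum_const, Finset.filter_mem_eq_inter,
      Finset.inter_eq_right.2 (htop τ hτ), nsmul_eq_mul, mul_div_cancel₀ _ (hcard τ hτ).ne']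

theorem lt_of_mem_cell₁ {K : PreAbstractSimplicialComplex V} {c : Finset (Finset V)}
    (hc : c ∈ sd K) {x : V → ℝ} (hx : x ∈ cell₁ c) {σ : Finset V} (hσ : σ ∈ c) {v w : V}
    (hv : v ∈ σ) (hw : w ∉ σ) : x w < x v := by
  classical
  obtain ⟨f, ⟨hpos, hzero, -⟩, rfl⟩ := hx
  have hcard : ∀ τ ∈ c, 0 < (τ.card : ℝ) := fun τ hτ => by
    exact_mod_cast Finset.card_pos.2 (mem_nonempty (hc.2.1 τ hτ))
  rw [sdMap_apply hzero, sdMap_apply hzero]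
  refine Finset.sum_lt_sum (fun τ hτ => ?_) ⟨σ, hσ, ?_⟩
  · have h0 := (div_pos (hpos τ hτ) (hcard τ hτ)).le
    by_cases hwτ : w ∈ τ
    · rcases hc.2.2.total hσ hτ with h | h
      · rw [if_pos hwτ, if_pos (h hv)]
      · exact absurd (h hwτ) hw
    · rw [if_neg hwτ]
      split_ifs
      · exact h0
      · exact le_rfl
  · rw [if_neg hw, if_pos hv]
    exact div_pos (hpos σ hσ) (hcard σ hσ)

theorem mem_of_lt_of_mem_cell₁ {K : PreAbstractSimplicialComplex V} {c : Finset (Finset V)}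
    (hc : c ∈ sd K) {x : V → ℝ} (hx : x ∈ cell₁ c) {σ : Finset V} (hne : σ.Nonempty)
    (hsep : ∀ v ∈ σ, 0 < x v ∧ ∀ w ∉ σ, x w < x v) : σ ∈ c := by
  classical
  obtain ⟨f, ⟨hpos, hzero, hsum⟩, rfl⟩ := hx
  -- the members of the chain that contain `σ`
  have hex : (c.filter (σ ⊆ ·)).Nonempty := by
    obtain ⟨τ, hτ, htop⟩ := exists_top hc
    refine ⟨τ, Finset.mem_filter.2 ⟨hτ, fun v hv => ?_⟩⟩
    by_contra h
    have := (sdMap_mem_openSimplex hc hτ htop ⟨hpos, hzero, hsum⟩).2.1 v h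
    exact absurd this (hsep v hv).1.ne'
  obtain ⟨τ, hτ, hmin⟩ := Finset.exists_min_image (c.filter (σ ⊆ ·)) Finset.card hex
  obtain ⟨hτc, hστ⟩ := Finset.mem_filter.1 hτ
  by_contra hσc
  have hss : ∃ w ∈ τ, w ∉ σ := by
    by_contra h
    push Not at h
    exact hσc (Finset.Subset.antisymm h hστ ▸ hτc)
  obtain ⟨w, hwτ, hwσ⟩ := hss
  -- every member of the chain either contains `τ` or misses some vertex of `σ`
  have key : ∃ v ∈ σ, ∀ ρ ∈ c, v ∈ ρ → τ ⊆ ρ := by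
    have hlow : ∀ ρ ∈ c, ¬ τ ⊆ ρ → ρ ⊆ τ ∧ ¬ σ ⊆ ρ := by
      intro ρ hρ h
      have h1 := (hc.2.2.total hτc hρ).resolve_left h
      refine ⟨h1, fun h2 => h ?_⟩
      exact (Finset.eq_of_subset_of_card_le h1 (hmin ρ (Finset.mem_filter.2 ⟨hρ, h2⟩))).ge
    by_cases hemp : (c.filter (¬ τ ⊆ ·)).Nonempty
    · obtain ⟨ρ, hρ, hmax⟩ := Finset.exists_max_image (c.filter (¬ τ ⊆ ·)) Finset.card hemp
      obtain ⟨hρc, hρ'⟩ := Finset.mem_filter.1 hρ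
      obtain ⟨v, hv, hvρ⟩ := Finset.not_subset.1 (hlow ρ hρc hρ').2
      refine ⟨v, hv, fun π hπ hvπ => ?_⟩
      by_contra h
      rcases hc.2.2.total hπ hρc with h1 | h1
      · exact hvρ (h1 hvπ)
      · have := Finset.eq_of_subset_of_card_le h1 (hmax π (Finset.mem_filter.2 ⟨hπ, h⟩))
        exact hvρ (this ▸ hvπ)
    · obtain ⟨v, hv⟩ := hne
      refine ⟨v, hv, fun ρ hρ _ => ?_⟩
      by_contra h
      exact hemp ⟨ρ, Finset.mem_filter.2 ⟨hρ, h⟩⟩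
  obtain ⟨v, hv, hkey⟩ := key
  refine absurd ((hsep v hv).2 w hwσ) (not_lt.2 ?_)
  rw [sdMap_apply hzero, sdMap_apply hzero]
  refine Finset.sum_le_sum fun ρ hρ => ?_
  by_cases h : v ∈ ρ
  · rw [if_pos h, if_pos (hkey ρ hρ h hwτ)]
  · rw [if_neg h]
    split_ifs
    · exact div_nonneg (hpos ρ hρ).le (Nat.cast_nonneg _)
    · exact le_rfl

theorem exists_chain (n : ℕ) : ∀ (s : Finset V) (y : V → ℝ), s.card = n → (∀ v ∈ s, 0 < y v) →
    (∀ v ∉ s, y v = 0) → ∃ (d : Finset (Finset V)) (g : Finset V → ℝ),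
      IsChain (· ⊆ ·) (d : Set (Finset V)) ∧ (∀ σ ∈ d, σ.Nonempty ∧ σ ⊆ s) ∧
      (∀ σ ∈ d, 0 < g σ) ∧ (∀ σ ∉ d, g σ = 0) ∧ (s.Nonempty → d.Nonempty) ∧
      ∀ v, y v = ∑ᶠ (σ : Finset V) (_ : v ∈ σ), g σ := by
  classical
  induction n using Nat.strong_induction_on with
  | _ n ih =>
    intro s y hn hpos hzero
    rcases s.eq_empty_or_nonempty with rfl | hs
    · refine ⟨∅, 0, by simp, by simp, by simp, by simp, by simp, fun v => ?_⟩
      simpa using hzero v (by simp)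
    · obtain ⟨u, hu, hmin⟩ := Finset.exists_min_image s y hs
      have hlt : (s.filter (y u < y ·)) ⊂ s := by
        refine Finset.filter_ssubset.2 ⟨u, hu, lt_irrefl _⟩
      obtain ⟨d, g, h1, h2, h3, h4, -, h6⟩ := ih _ (hn ▸ Finset.card_lt_card hlt)
        (s.filter (y u < y ·)) (fun v => if v ∈ s then y v - y u else 0) rfl
        (fun v hv => by
          obtain ⟨hv1, hv2⟩ := Finset.mem_filter.1 hv
          simpa [hv1] using hv2)
        (fun v hv => by
          by_cases hvs : v ∈ s
          · have := le_antisymm (not_lt.1 fun h => hv (Finset.mem_filter.2 ⟨hvs, h⟩)) (hmin v hvs)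
            simp [this]
          · simp [hvs])
      have hsd : s ∉ d := fun h => hlt.not_subset ((h2 s h).2)
      have hds : ∀ σ ∈ d, σ ⊆ s := fun σ hσ => (h2 σ hσ).2.trans hlt.subset
      refine ⟨insert s d, Function.update g s (y u), ?_, ?_, ?_, ?_, ?_, ?_⟩
      · rw [Finset.coe_insert]
        exact h1.insert fun σ hσ _ => Or.inr (hds σ hσ)
      · intro σ hσ
        rcases Finset.mem_insert.1 hσ with rfl | hσ
        · exact ⟨hs, subset_rfl⟩
        · exact ⟨(h2 σ hσ).1, hds σ hσ⟩
      · intro σ hσ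
        rcases Finset.mem_insert.1 hσ with rfl | hσ'
        · simpa using hpos u hu
        · rw [Function.update_of_ne (by rintro rfl; exact hsd hσ')]
          exact h3 σ hσ'
      · intro σ hσ
        rw [Finset.mem_insert, not_or] at hσ
        rw [Function.update_of_ne hσ.1]
        exact h4 σ hσ.2
      · exact fun _ => Finset.insert_nonempty _ _
      · intro v
        have e : ∀ (g : Finset V → ℝ) (σ : Finset V), (∑ᶠ (_ : v ∈ σ), g σ) =
            if v ∈ σ then g σ else 0 := fun g σ => finsum_eq_if
        have hsupp : ∀ (g : Finset V → ℝ) (d : Finset (Finset V)), (∀ σ ∉ d, g σ = 0) →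
            (∑ᶠ (σ : Finset V) (_ : v ∈ σ), g σ) = ∑ σ ∈ d, if v ∈ σ then g σ else 0 := by
          intro g d hd
          simp_rw [e]
          refine finsum_eq_sum_of_support_subset _ fun σ hσ => ?_
          by_contra hc
          apply hσ
          simp [hd σ hc]
        have h6v := h6 v
        rw [hsupp g d h4] at h6v
        rw [hsupp _ (insert s d) (fun σ hσ => by
          rw [Finset.mem_insert, not_or] at hσ
          rw [Function.update_of_ne hσ.1]
          exact h4 σ hσ.2), Finset.sum_insert hsd]
        have : (∑ σ ∈ d, if v ∈ σ then Function.update g s (y u) σ else 0) =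
            ∑ σ ∈ d, if v ∈ σ then g σ else 0 :=
          Finset.sum_congr rfl fun σ hσ => by
            rw [Function.update_of_ne (by rintro rfl; exact hsd hσ)]
        rw [this, ← h6v, Function.update_self]
        by_cases hvs : v ∈ s
        · simp [hvs]
        · simp [hvs, hzero v hvs]

theorem exists_mem_cell₁ {K : PreAbstractSimplicialComplex V} {s : Finset V} (hs : s ∈ K)
    {x : V → ℝ} (hx : x ∈ openSimplex s) : ∃ c ∈ sd K, x ∈ cell₁ c := by
  classical
  obtain ⟨hpos, hzero, hsum⟩ := hx
  obtain ⟨d, g, h1, h2, h3, h4, h5, h6⟩ := exists_chain _ s x rfl hpos hzero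
  have hcard : ∀ τ ∈ d, 0 < (τ.card : ℝ) := fun τ hτ => by
    exact_mod_cast Finset.card_pos.2 (h2 τ hτ).1
  have hfg : ∀ σ : Finset V, (σ.card : ℝ) * g σ / σ.card = g σ := by
    intro σ
    by_cases hσ : σ ∈ d
    · rw [mul_div_cancel_left₀ _ (hcard σ hσ).ne']
    · simp [h4 σ hσ]
  have hmap : sdMap (fun σ => (σ.card : ℝ) * g σ) = x := by
    funext v
    rw [sdMap, h6 v]
    simp_rw [hfg]
  have hz : ∀ σ ∉ d, (σ.card : ℝ) * g σ = 0 := fun σ hσ => by simp [h4 σ hσ]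
  refine ⟨d, ⟨h5 (mem_nonempty hs), fun σ hσ => (K.isRelLowerSet_faces hs).2 (h2 σ hσ).2 (h2 σ hσ).1,
    h1⟩, _, ⟨fun σ hσ => mul_pos (hcard σ hσ) (h3 σ hσ), hz, ?_⟩, hmap⟩
  rw [← hsum, ← hmap]
  simp_rw [sdMap_apply hz]
  rw [Finset.sum_comm]
  refine Finset.sum_congr rfl fun τ hτ => ?_
  rw [← Finset.sum_filter, Finset.sum_const, Finset.filter_mem_eq_inter,
    Finset.inter_eq_right.2 (h2 τ hτ).2, nsmul_eq_mul, mul_div_cancel₀ _ (hcard τ hτ).ne']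

theorem convex_cell₁ {c d : Finset (Finset V)} (hcd : c ⊆ d)
    {x y : V → ℝ} (hx : x ∈ cell₁ c) (hy : y ∈ cell₁ d) {a b : ℝ} (ha : 0 ≤ a) (hb : 0 < b)
    (hab : a + b = 1) : a • x + b • y ∈ cell₁ d := by
  classical
  obtain ⟨f, ⟨f1, f2, f3⟩, rfl⟩ := hx
  obtain ⟨g, ⟨g1, g2, g3⟩, rfl⟩ := hy
  have f2' : ∀ σ ∉ d, f σ = 0 := fun σ hσ => f2 σ fun h => hσ (hcd h)
  have f0 : ∀ σ, 0 ≤ f σ := fun σ => by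
    by_cases h : σ ∈ c
    · exact (f1 σ h).le
    · rw [f2 σ h]
  have f3' : ∑ σ ∈ d, f σ = 1 := by
    rw [← f3]
    exact (Finset.sum_subset hcd fun σ _ h => f2 σ h).symm
  refine ⟨a • f + b • g, ⟨fun σ hσ => ?_, fun σ hσ => ?_, ?_⟩, ?_⟩
  · exact add_pos_of_nonneg_of_pos (mul_nonneg ha (f0 σ)) (mul_pos hb (g1 σ hσ))
  · simp [f2' σ hσ, g2 σ hσ]
  · simp [Finset.sum_add_distrib, ← Finset.mul_sum, f3', g3, hab]
  · funext v
    rw [sdMap_apply (c := d) (fun σ hσ => by simp [f2' σ hσ, g2 σ hσ])]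
    simp only [Pi.add_apply, Pi.smul_apply, smul_eq_mul]
    rw [sdMap_apply f2', sdMap_apply g2, Finset.mul_sum, Finset.mul_sum, ← Finset.sum_add_distrib]
    refine Finset.sum_congr rfl fun σ _ => ?_
    split_ifs
    · ring
    · ring

theorem openSimplex_inj {s t : Finset V} {x : V → ℝ} (hs : x ∈ openSimplex s)
    (ht : x ∈ openSimplex t) : s = t := by
  ext v
  constructor
  · intro h
    by_contra h'
    exact (hs.1 v h).ne' (ht.2.1 v h')
  · intro h
    by_contra h'
    exact (ht.1 v h).ne' (hs.2.1 v h')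

theorem cell₁_inj {K : PreAbstractSimplicialComplex V} {c d : Finset (Finset V)} (hc : c ∈ sd K)
    (hd : d ∈ sd K) {x : V → ℝ} (hxc : x ∈ cell₁ c) (hxd : x ∈ cell₁ d) : c = d := by
  have key : ∀ c ∈ sd K, ∀ d ∈ sd K, x ∈ cell₁ c → x ∈ cell₁ d → c ⊆ d := by
    intro c hc d hd hxc hxd σ hσ
    refine mem_of_lt_of_mem_cell₁ hd hxd (mem_nonempty (hc.2.1 σ hσ)) fun v hv =>
      ⟨?_, fun w hw => lt_of_mem_cell₁ hc hxc hσ hv hw⟩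
    obtain ⟨τ, hτ, htop⟩ := exists_top hc
    obtain ⟨f, hf, rfl⟩ := hxc
    exact (sdMap_mem_openSimplex hc hτ htop hf).1 v (htop σ hσ hv)
  exact (key c hc d hd hxc hxd).antisymm (key d hd c hc hxd hxc)

theorem sdMap_inj {K : PreAbstractSimplicialComplex V} {c d : Finset (Finset V)} (hc : c ∈ sd K)
    (hd : d ∈ sd K) {f g : Finset V → ℝ} (hf : f ∈ openSimplex c) (hg : g ∈ openSimplex d)
    (h : sdMap f = sdMap g) : f = g := by
  classical
  obtain rfl : c = d := cell₁_inj hc hd ⟨f, hf, rfl⟩ ⟨g, hg, h.symm⟩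
  by_contra hne
  have hex : (c.filter fun σ => f σ ≠ g σ).Nonempty := by
    obtain ⟨σ, hσ⟩ := Function.ne_iff.1 hne
    refine ⟨σ, Finset.mem_filter.2 ⟨?_, hσ⟩⟩
    by_contra hσc
    exact hσ ((hf.2.1 σ hσc).trans (hg.2.1 σ hσc).symm)
  obtain ⟨σ, hσ, hmax⟩ := Finset.exists_max_image _ Finset.card hex
  obtain ⟨hσc, hσfg⟩ := Finset.mem_filter.1 hσ
  -- a vertex of `σ` that lies in no smaller member of the chain
  have hv : ∃ v ∈ σ, ∀ τ ∈ c, v ∈ τ → σ ⊆ τ := by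
    by_cases hemp : (c.filter (· ⊂ σ)).Nonempty
    · obtain ⟨ρ, hρ, hρmax⟩ := Finset.exists_max_image (c.filter (· ⊂ σ)) Finset.card hemp
      obtain ⟨hρc, hρσ⟩ := Finset.mem_filter.1 hρ
      obtain ⟨v, hv, hvρ⟩ := Finset.exists_of_ssubset hρσ
      refine ⟨v, hv, fun τ hτ hvτ => ?_⟩
      by_contra hn
      have hτσ : τ ⊂ σ := ⟨(hc.2.2.total hσc hτ).resolve_left hn, hn⟩
      rcases hc.2.2.total hτ hρc with h1 | h1
      · exact hvρ (h1 hvτ)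
      · have := Finset.eq_of_subset_of_card_le h1 (hρmax τ (Finset.mem_filter.2 ⟨hτ, hτσ⟩))
        exact hvρ (this ▸ hvτ)
    · obtain ⟨v, hv⟩ := mem_nonempty (hc.2.1 σ hσc)
      refine ⟨v, hv, fun τ hτ _ => ?_⟩
      by_contra hn
      exact hemp ⟨τ, Finset.mem_filter.2 ⟨hτ, (hc.2.2.total hσc hτ).resolve_left hn, hn⟩⟩
  obtain ⟨v, hvσ, hv⟩ := hv
  have hsum := congrFun h v
  rw [sdMap_apply hf.2.1, sdMap_apply hg.2.1, ← sub_eq_zero, ← Finset.sum_sub_distrib,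
    Finset.sum_eq_single_of_mem σ hσc, if_pos hvσ, if_pos hvσ, ← sub_div] at hsum
  · rcases div_eq_zero_iff.1 hsum with h0 | h0
    · exact hσfg (sub_eq_zero.1 h0)
    · have := Finset.card_pos.2 (mem_nonempty (hc.2.1 σ hσc))
      exact this.ne' (by exact_mod_cast h0)
  · intro τ hτ hτσ
    by_cases hvτ : v ∈ τ
    · have hfg : f τ = g τ := by
        by_contra hn
        have := hmax τ (Finset.mem_filter.2 ⟨hτ, hn⟩)
        exact hτσ (Finset.eq_of_subset_of_card_le (hv τ hτ hvτ) this).symm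
      rw [hfg, sub_self]
    · rw [if_neg hvτ, if_neg hvτ, sub_self]

theorem cell₂_inj {K : PreAbstractSimplicialComplex V} {C D : Finset (Finset (Finset V))}
    (hC : C ∈ sd (sd K)) (hD : D ∈ sd (sd K)) {x : V → ℝ} (hxC : x ∈ cell₂ C)
    (hxD : x ∈ cell₂ D) : C = D := by
  obtain ⟨_, ⟨f, hf, rfl⟩, rfl⟩ := hxC
  obtain ⟨_, ⟨g, hg, rfl⟩, h⟩ := hxD
  obtain ⟨c, hc, hct⟩ := exists_top hC
  obtain ⟨d, hd, hdt⟩ := exists_top hD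
  have := sdMap_inj (hC.2.1 c hc) (hD.2.1 d hd) (sdMap_mem_openSimplex hC hc hct hf)
    (sdMap_mem_openSimplex hD hd hdt hg) h.symm
  exact cell₁_inj hC hD ⟨f, hf, rfl⟩ ⟨g, hg, this.symm⟩

end Simplicial

section Topological

/-- A simplicial pair `(K, K₀)`: a simplicial complex together with a subcomplex. -/
structure SimplicialPair (V : Type v) where
  /-- the simplicial complex -/
  K : PreAbstractSimplicialComplex V
  /-- the subcomplex -/
  K₀ : PreAbstractSimplicialComplex V
  le : K₀ ≤ K

/-- The space `|K - K₀|`: the union of the open simplices of `K` that are not in `K₀`.  It carries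
the topology of pointwise convergence of barycentric coordinates.  As soon as this space is locally
compact, each simplex of `K - K₀` lies in finitely many simplices of `K`, and then this is also the
topology induced from the weak topology of `|K|`. -/
def SimplicialPair.space {V : Type v} (P : SimplicialPair V) : Set (V → ℝ) :=
  {x | ∃ s ∈ P.K, s ∉ P.K₀ ∧ x ∈ openSimplex s}

/-- A triangulation of `X`: a simplicial pair and a homeomorphism `|K - K₀| ≃ X`.  The strata are
the images of the open simplices in `K - K₀`. -/
structure Triangulation (X : Type u) [TopologicalSpace X] (V : Type v) extends
    SimplicialPair V where
  /-- the homeomorphism onto `X` -/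
  homeo : toSimplicialPair.space ≃ₜ X

namespace Triangulation

variable {X : Type u} [TopologicalSpace X] {V : Type v} (T : Triangulation X V)

/-- The barycentric coordinates of a point of a triangulated space. -/
def coord (x : X) : V → ℝ := (T.homeo.symm x).1

theorem coord_mem (x : X) : T.coord x ∈ T.space := (T.homeo.symm x).2

theorem coord_homeo (y : T.space) : T.coord (T.homeo y) = y.1 := by simp [coord]

theorem isEmbedding_coord : Topology.IsEmbedding T.coord :=
  Topology.IsEmbedding.subtypeVal.comp T.homeo.symm.isEmbedding

theorem isConnected_of_starConvex {U : Set X} {x : X} (hx : x ∈ U)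
    (h : StarConvex ℝ (T.coord x) (T.coord '' U)) : IsConnected U := by
  refine ⟨⟨x, hx⟩, ?_⟩
  rw [← T.isEmbedding_coord.isInducing.isPreconnected_image]
  exact (StarConvex.isPathConnected h ⟨x, hx, rfl⟩).isConnected.isPreconnected

/-- A basic open set `U` of `X` associated to the simplex `s`, for a subdivision `J` of `K` whose
simplex `t` occupies the cell `cell t ⊆ |K|`: an open set that contains a point of the open simplex
`s`, lies in the open star of `s`, and is star-shaped about that point in barycentric coordinates.
(These are images of local parametrizations `ℝᵈ × C(L) → X` of the stratified space, and they form
a basis of the topology which contains the open stars of all simplices.) -/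
def IsBasicAt {I : Type w} (J : PreAbstractSimplicialComplex I) (cell : Finset I → Set (V → ℝ))
    (s : Finset I) (U : Opens X) : Prop :=
  s ∈ J ∧ (∀ y ∈ U, ∃ t ∈ J, s ⊆ t ∧ T.coord y ∈ cell t) ∧
    ∃ x ∈ U, T.coord x ∈ cell s ∧ StarConvex ℝ (T.coord x) (T.coord '' (U : Set X))

/-- `U` is a basic open set of the triangulation by `K`. -/
def IsBasic (U : Opens X) : Prop := ∃ σ, T.IsBasicAt T.K openSimplex σ U

/-- `U` is a basic open set of the second subdivision `K²`, associated to a simplex `C` of `K²`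
whose image `Σ(C)` under the dilation is not in the first subdivision of `K₀`, that is, which `Σ`
maps into `X = |K - K₀|`. -/
def IsDilationBasic (U : Opens X) : Prop :=
  ∃ C, dilation C ∉ sd T.K₀ ∧ T.IsBasicAt (sd (sd T.K)) cell₂ C U

/-- The open star in `X` of the simplex `e` of the first subdivision `K¹`. -/
def star₁ (e : Finset (Finset V)) : Set X :=
  {x | ∃ d ∈ sd T.K, e ⊆ d ∧ T.coord x ∈ cell₁ d}

/-- The union of the sets `st Σ(C)` over all simplices `C` of `K²` that meet `U`.  If `U` is a basic
open set of `K²` associated to `C`, then this is `st Σ(C)`, see `dilateSet_eq`. -/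
def dilateSet (U : Set X) : Set X :=
  {y | ∃ C ∈ sd (sd T.K), (∃ x ∈ U, T.coord x ∈ cell₂ C) ∧ y ∈ T.star₁ (dilation C)}

/-- The part `|L² - cl st L₀²|` of a space triangulated by a simplicial pair `(L, L₀)`.  It is the
union of the open simplices outside a subcomplex of `L²`, hence open if the space is a manifold; its
open sets are the open sets of the whole space that it contains. -/
def shrinking : Set X :=
  {x | ∃ C ∈ sd (sd T.K), C ∉ closedStar (sd (sd T.K)) (sd (sd T.K₀)) ∧ T.coord x ∈ cell₂ C}

theorem exists_star₁ (x : X) : ∃ d ∈ sd T.K, T.coord x ∈ cell₁ d := by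
  obtain ⟨s, hs, -, hx⟩ := T.coord_mem x
  exact exists_mem_cell₁ hs hx

theorem mem_space_of_mem_cell₁ {d : Finset (Finset V)} (hd : d ∈ sd T.K) (hd₀ : d ∉ sd T.K₀)
    {x : V → ℝ} (hx : x ∈ cell₁ d) : x ∈ T.space := by
  obtain ⟨σ, hσ, htop⟩ := exists_top hd
  obtain ⟨f, hf, rfl⟩ := hx
  refine ⟨σ, hd.2.1 σ hσ, fun h => hd₀ ⟨hd.1, fun τ hτ => ?_, hd.2.2⟩,
    sdMap_mem_openSimplex hd hσ htop hf⟩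
  exact (T.K₀.isRelLowerSet_faces h).2 (htop τ hτ) (mem_nonempty (hd.2.1 τ hτ))

theorem isOpen_star₁ {e : Finset (Finset V)} (he : e ∈ sd T.K) : IsOpen (T.star₁ e) := by
  classical
  have hcont : ∀ v, Continuous fun y => T.coord y v := fun v =>
    (continuous_apply v).comp T.isEmbedding_coord.continuous
  have h : T.star₁ e =
      ⋂ σ ∈ e, {y | ∀ v ∈ σ, 0 < T.coord y v ∧ ∀ w ∉ σ, T.coord y w < T.coord y v} := by
    ext y
    simp only [Set.mem_iInter, Set.mem_ofPred_eq]
    constructor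
    · rintro ⟨d, hd, hed, hy⟩ σ hσ v hv
      refine ⟨?_, fun w hw => lt_of_mem_cell₁ hd hy (hed hσ) hv hw⟩
      obtain ⟨τ, hτ, htop⟩ := exists_top hd
      obtain ⟨f, hf, hfy⟩ := hy
      rw [← hfy]
      exact (sdMap_mem_openSimplex hd hτ htop hf).1 v (htop σ (hed hσ) hv)
    · intro hy
      obtain ⟨d, hd, hyd⟩ := T.exists_star₁ y
      exact ⟨d, hd, fun σ hσ =>
        mem_of_lt_of_mem_cell₁ hd hyd (mem_nonempty (he.2.1 σ hσ)) (hy σ hσ), hyd⟩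
  rw [h]
  refine isOpen_biInter_finset fun σ _ => isOpen_iff_mem_nhds.2 fun x hx => ?_
  obtain ⟨s, -, -, -, hs0, hs1⟩ := T.coord_mem x
  -- only finitely many coordinates matter near `x`
  have hN : (⋂ v ∈ σ, ({y | 0 < T.coord y v} ∩ {y | 1 - ∑ u ∈ s, T.coord y u < T.coord y v} ∩
      ⋂ w ∈ s \ σ, {y | T.coord y w < T.coord y v})) ∈ nhds x := by
    refine (isOpen_biInter_finset fun v _ => ((isOpen_lt continuous_const (hcont v)).inter
      (isOpen_lt (continuous_const.sub (continuous_finsetSum _ fun u _ => hcont u))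
        (hcont v))).inter (isOpen_biInter_finset fun w _ => isOpen_lt (hcont w) (hcont v))).mem_nhds
      ?_
    refine Set.mem_iInter₂.2 fun v hv => ⟨⟨(hx v hv).1, ?_⟩, Set.mem_iInter₂.2 fun w hw =>
      (hx v hv).2 w (Finset.mem_sdiff.1 hw).2⟩
    change 1 - ∑ u ∈ s, T.coord x u < T.coord x v
    rw [hs1, sub_self]
    exact (hx v hv).1
  refine Filter.mem_of_superset hN fun y hy v hv => ?_
  obtain ⟨⟨h1, h2⟩, h3⟩ := Set.mem_iInter₂.1 hy v hv
  refine ⟨h1, fun w hw => ?_⟩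
  by_cases hws : w ∈ s
  · exact Set.mem_iInter₂.1 h3 w (Finset.mem_sdiff.2 ⟨hws, hw⟩)
  · refine lt_of_le_of_lt ?_ h2
    obtain ⟨t, -, -, ht⟩ := T.coord_mem y
    have h0 : ∀ u, 0 ≤ T.coord y u := fun u => by
      by_cases hu : u ∈ t
      · exact (ht.1 u hu).le
      · exact (ht.2.1 u hu).ge
    have h4 : ∑ u ∈ insert w s, T.coord y u ≤ 1 := by
      rw [← ht.2.2]
      calc ∑ u ∈ insert w s, T.coord y u ≤ ∑ u ∈ insert w s ∪ t, T.coord y u :=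
            Finset.sum_le_sum_of_subset_of_nonneg Finset.subset_union_left fun u _ _ => h0 u
        _ = ∑ u ∈ t, T.coord y u :=
            (Finset.sum_subset Finset.subset_union_right fun u _ hu => ht.2.1 u hu).symm
    rw [Finset.sum_insert hws] at h4
    linarith

theorem isConnected_star₁ {e : Finset (Finset V)} (he : e ∈ sd T.K) (he₀ : e ∉ sd T.K₀) :
    IsConnected (T.star₁ e) := by
  classical
  have hcell : (cell₁ e).Nonempty := by
    refine ⟨_, fun σ => if σ ∈ e then (e.card : ℝ)⁻¹ else 0, ⟨fun σ hσ => ?_, fun σ hσ => ?_, ?_⟩,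
      rfl⟩
    · simp only [if_pos hσ]
      exact inv_pos.2 (by exact_mod_cast Finset.card_pos.2 he.1)
    · simp only [if_neg hσ]
    · rw [Finset.sum_congr rfl fun σ hσ => if_pos hσ, Finset.sum_const, nsmul_eq_mul]
      exact mul_inv_cancel₀ (by exact_mod_cast (Finset.card_pos.2 he.1).ne')
  obtain ⟨z, hz⟩ := hcell
  have hzs := T.mem_space_of_mem_cell₁ he he₀ hz
  have hzx : T.coord (T.homeo ⟨z, hzs⟩) = z := T.coord_homeo _
  refine T.isConnected_of_starConvex (x := T.homeo ⟨z, hzs⟩)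
    ⟨e, he, subset_rfl, by rwa [hzx]⟩ ?_
  rw [hzx]
  rintro _ ⟨y, ⟨d, hd, hed, hy⟩, rfl⟩ a b ha hb hab
  rcases hb.eq_or_lt with rfl | hb
  · refine ⟨T.homeo ⟨z, hzs⟩, ⟨e, he, subset_rfl, by rwa [hzx]⟩, ?_⟩
    rw [hzx, show a = 1 by linarith]
    simp
  · have h1 := convex_cell₁ hed hz hy ha hb hab
    have hd₀ : d ∉ sd T.K₀ := fun h =>
      he₀ ⟨he.1, fun σ hσ => h.2.1 σ (hed hσ), he.2.2⟩
    have h2 := T.mem_space_of_mem_cell₁ hd hd₀ h1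
    exact ⟨T.homeo ⟨_, h2⟩, ⟨d, hd, hed, by rwa [T.coord_homeo]⟩, T.coord_homeo _⟩

variable {T}

theorem IsBasic.isConnected {U : Opens X} (h : T.IsBasic U) : IsConnected (U : Set X) := by
  obtain ⟨σ, -, -, x, hx, -, hs⟩ := h
  exact T.isConnected_of_starConvex hx hs

/-- A basic open set of the second subdivision is a basic open set. -/
theorem IsDilationBasic.isBasic {U : Opens X} (h : T.IsDilationBasic U) : T.IsBasic U := by
  obtain ⟨C, -, hC, hU, x, hxU, hx, hs⟩ := h
  have key : ∀ C ∈ sd (sd T.K), ∃ c ∈ C, (∀ c' ∈ C, c' ⊆ c) ∧ ∃ σ ∈ c, (∀ τ ∈ c, τ ⊆ σ) ∧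
      σ ∈ T.K ∧ cell₂ C ⊆ openSimplex σ := by
    intro C hC
    obtain ⟨c, hc, htop⟩ := exists_top hC
    obtain ⟨σ, hσ, htop'⟩ := exists_top (hC.2.1 c hc)
    refine ⟨c, hc, htop, σ, hσ, htop', (hC.2.1 c hc).2.1 σ hσ, ?_⟩
    rintro _ ⟨_, ⟨f, hf, rfl⟩, rfl⟩
    exact sdMap_mem_openSimplex (hC.2.1 c hc) hσ htop' (sdMap_mem_openSimplex hC hc htop hf)
  obtain ⟨c, hc, -, σ, hσ, -, hσK, hσx⟩ := key C hC
  refine ⟨σ, hσK, fun y hy => ?_, x, hxU, hσx hx, hs⟩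
  obtain ⟨C', hC', hCC', hyC'⟩ := hU y hy
  obtain ⟨c', hc', htop, τ, hτ, htop', hτK, hτy⟩ := key C' hC'
  exact ⟨τ, hτK, htop' σ (htop c (hCC' hc) hσ), hτy hyC'⟩

/-- On a basic open set `U` of `K²` associated to `C`, the dilation is `st Σ(C)`. -/
theorem dilateSet_eq {U : Opens X} {C : Finset (Finset (Finset V))}
    (h : T.IsBasicAt (sd (sd T.K)) cell₂ C U) : T.dilateSet U = T.star₁ (dilation C) := by
  classical
  obtain ⟨hC, hU, x, hxU, hx, -⟩ := h
  ext y
  constructor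
  · rintro ⟨D, hD, ⟨z, hzU, hz⟩, d, hd, hDd, hy⟩
    obtain ⟨C', hC', hCC', hzC'⟩ := hU z hzU
    obtain rfl := cell₂_inj hD hC' hz hzC'
    exact ⟨d, hd, (Finset.image_subset_image hCC').trans hDd, hy⟩
  · exact fun hy => ⟨C, hC, ⟨x, hxU, hx⟩, hy⟩

theorem IsDilationBasic.isOpen {U : Opens X} (h : T.IsDilationBasic U) :
    IsOpen (T.dilateSet U) := by
  obtain ⟨C, -, hC⟩ := h
  rw [dilateSet_eq hC]
  exact T.isOpen_star₁ (dilation_mem hC.1)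

theorem IsDilationBasic.isConnected {U : Opens X} (h : T.IsDilationBasic U) :
    IsConnected (T.dilateSet U) := by
  obtain ⟨C, hC₀, hC⟩ := h
  rw [dilateSet_eq hC]
  exact T.isConnected_star₁ (dilation_mem hC.1) hC₀

theorem dilateSet_mono {U V : Set X} (h : U ⊆ V) : T.dilateSet U ⊆ T.dilateSet V := by
  rintro y ⟨C, hC, ⟨x, hx, hxC⟩, hy⟩
  exact ⟨C, hC, ⟨x, h hx, hxC⟩, hy⟩

end Triangulation
end Topological

section Sheaves

/-- The poset of non-empty connected open sets. -/
abbrev ConnOpens (X : Type u) [TopologicalSpace X] : Type u :=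
  {U : Opens X // IsConnected (U : Set X)}

/-- A bisheaf around `X`: a sheaf, a cosheaf, and for each non-empty connected open set `U` a map
from the sections of the sheaf to those of the cosheaf, compatible with all inclusions `V ⊆ U`. -/
structure Bisheaf (X : Type u) [TopologicalSpace X] where
  /-- the sheaf -/
  sheaf : (Opens X)ᵒᵖ ⥤ AddCommGrpCat.{w}
  isSheaf : TopCat.Presheaf.IsSheaf (X := TopCat.of X) sheaf
  /-- the cosheaf -/
  cosheaf : Opens X ⥤ AddCommGrpCat.{w}
  isCosheaf : TopCat.Presheaf.IsSheaf (X := TopCat.of X) (C := AddCommGrpCat.{w}ᵒᵖ) cosheaf.op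
  /-- the maps from the sheaf to the cosheaf -/
  map : ∀ U : ConnOpens X, sheaf.obj (op U.1) ⟶ cosheaf.obj U.1
  comm : ∀ {V U : ConnOpens X} (f : V.1 ⟶ U.1),
    sheaf.map f.op ≫ map V ≫ cosheaf.map f = map U

/-- A bisheaf recorded by its values on the members of a poset `B` of open sets (in the cases below,
a basis of the topology by connected open sets, which determines a constructible bisheaf). -/
structure BisheafOn (B : Type v) [Preorder B] where
  /-- the values of the sheaf -/
  sheaf : Bᵒᵖ ⥤ AddCommGrpCat.{w}
  /-- the values of the cosheaf -/
  cosheaf : B ⥤ AddCommGrpCat.{w}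
  /-- the maps from the sheaf to the cosheaf -/
  map : ∀ U : B, sheaf.obj (op U) ⟶ cosheaf.obj U
  comm : ∀ {V U : B} (f : V ⟶ U), sheaf.map f.op ≫ map V ≫ cosheaf.map f = map U

/-- A local system, recorded (as a colocal system) by its values on a basis `B` of the topology by
connected open sets: a functor that sends every inclusion to an isomorphism. -/
structure LocalSystem (B : Type v) [Preorder B] where
  /-- the underlying functor -/
  functor : B ⥤ AddCommGrpCat.{w}
  isIso : ∀ {V U : B} (f : V ⟶ U), IsIso (functor.map f)

namespace BisheafOn
variable {B : Type v} [Preorder B] {B' : Type v'} [Preorder B']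

/-- Pull-back of a bisheaf along a monotone map between the indexing posets. -/
def pullback (F : BisheafOn.{v, w} B) (f : B' →o B) : BisheafOn.{v', w} B' where
  sheaf := f.monotone.functor.op ⋙ F.sheaf
  cosheaf := f.monotone.functor ⋙ F.cosheaf
  map U := F.map (f U)
  comm g := F.comm (f.monotone.functor.map g)

/-- A family of subgroups is a sub-episheaf if every restriction map carries it onto itself.  If
the sheaf is constructible then such a subsheaf is constructible too. -/
def IsSubEpisheaf (F : Bᵒᵖ ⥤ AddCommGrpCat.{w}) (E : ∀ U, AddSubgroup (F.obj U)) : Prop :=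
  ∀ ⦃U V : Bᵒᵖ⦄ (f : U ⟶ V), (E U).map (F.map f).hom = E V

/-- The maximal sub-episheaf, the sum of all sub-episheaves. -/
def epiSubgroup (F : Bᵒᵖ ⥤ AddCommGrpCat.{w}) (U : Bᵒᵖ) : AddSubgroup (F.obj U) :=
  ⨆ E : {E : ∀ U, AddSubgroup (F.obj U) // IsSubEpisheaf F E}, E.1 U

theorem epiSubgroup_isSubEpisheaf (F : Bᵒᵖ ⥤ AddCommGrpCat.{w}) :
    IsSubEpisheaf F (epiSubgroup F) := by
  intro U V f
  unfold epiSubgroup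
  rw [AddSubgroup.map_iSup]
  exact iSup_congr fun E => E.2 f

/-- Epification: the maximal sub-episheaf, as a functor. -/
def epi (F : Bᵒᵖ ⥤ AddCommGrpCat.{w}) : Bᵒᵖ ⥤ AddCommGrpCat.{w} where
  obj U := AddCommGrpCat.of (epiSubgroup F U)
  map {U V} f := AddCommGrpCat.ofHom
    (((F.map f).hom.comp (epiSubgroup F U).subtype).codRestrict (epiSubgroup F V) fun x => by
      rw [← epiSubgroup_isSubEpisheaf F f]
      exact ⟨x.1, x.2, rfl⟩)
  map_id U := by ext x; exact congrArg (fun k => k.hom x.1) (F.map_id U)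
  map_comp f g := by ext x; exact congrArg (fun k => k.hom x.1) (F.map_comp f g)

/-- A family of subgroups is the kernel of a quotient-monocosheaf if the extension maps induce
injective maps of the quotients, that is, if each subgroup is the preimage of the next.  If the
cosheaf is constructible then so is the quotient. -/
def IsMonoKernel (G : B ⥤ AddCommGrpCat.{w}) (N : ∀ U, AddSubgroup (G.obj U)) : Prop :=
  ∀ ⦃V U : B⦄ (f : V ⟶ U), (N U).comap (G.map f).hom = N V

/-- The kernel of the minimal quotient-monocosheaf. -/
def monoKernel (G : B ⥤ AddCommGrpCat.{w}) (U : B) : AddSubgroup (G.obj U) :=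
  ⨅ N : {N : ∀ U, AddSubgroup (G.obj U) // IsMonoKernel G N}, N.1 U

theorem monoKernel_isMonoKernel (G : B ⥤ AddCommGrpCat.{w}) :
    IsMonoKernel G (monoKernel G) := by
  intro V U f
  unfold monoKernel
  rw [AddSubgroup.comap_iInf]
  exact iInf_congr fun N => N.2 f

/-- Monofication: the minimal quotient-monocosheaf. -/
def mono (G : B ⥤ AddCommGrpCat.{w}) : B ⥤ AddCommGrpCat.{w} where
  obj U := AddCommGrpCat.of (G.obj U ⧸ monoKernel G U)
  map {V U} f := AddCommGrpCat.ofHom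
    (QuotientAddGroup.map (monoKernel G V) (monoKernel G U) (G.map f).hom
      (monoKernel_isMonoKernel G f).ge)
  map_id U := by
    ext x
    exact congrArg (fun k => QuotientAddGroup.mk' (monoKernel G U) (k.hom x)) (G.map_id U)
  map_comp {U V W} f g := by
    ext x
    exact congrArg (fun k => QuotientAddGroup.mk' (monoKernel G W) (k.hom x)) (G.map_comp f g)

/-- Isofication. -/
def iso (F : BisheafOn.{v, w} B) : BisheafOn.{v, w} B where
  sheaf := epi F.sheaf
  cosheaf := mono F.cosheaf
  map U := AddCommGrpCat.ofHom
    ((QuotientAddGroup.mk' (monoKernel F.cosheaf U)).comp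
      ((F.map U).hom.comp (epiSubgroup F.sheaf (op U)).subtype))
  comm {V U} f := by
    ext x
    have h := congrArg (fun k => k.hom x.1) (F.comm f)
    exact congrArg (QuotientAddGroup.mk' (monoKernel F.cosheaf U)) h

/-- Isobisheaves: the sheaf is an episheaf and the cosheaf is a monocosheaf. -/
structure IsIsobisheaf (F : BisheafOn.{v, w} B) : Prop where
  surjective : ∀ ⦃U V : Bᵒᵖ⦄ (f : U ⟶ V), Function.Surjective (F.sheaf.map f).hom
  injective : ∀ ⦃V U : B⦄ (f : V ⟶ U), Function.Injective (F.cosheaf.map f).hom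

theorem isIsobisheaf_iso (F : BisheafOn.{v, w} B) : F.iso.IsIsobisheaf where
  surjective U V f := by
    rintro ⟨y, hy⟩
    rw [← epiSubgroup_isSubEpisheaf F.sheaf f] at hy
    obtain ⟨x, hx, rfl⟩ := hy
    exact ⟨⟨x, hx⟩, rfl⟩
  injective V U f := by
    refine (injective_iff_map_eq_zero _).2 fun x hx => ?_
    obtain ⟨x, rfl⟩ := QuotientAddGroup.mk_surjective x
    refine (QuotientAddGroup.eq_zero_iff x).2 ?_
    rw [← monoKernel_isMonoKernel F.cosheaf f]
    exact (QuotientAddGroup.eq_zero_iff ((F.cosheaf.map f).hom x)).1 hx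

theorem IsIsobisheaf.pullback {F : BisheafOn.{v, w} B} (h : F.IsIsobisheaf) (f : B' →o B) :
    (F.pullback f).IsIsobisheaf where
  surjective _ _ g := h.surjective (f.monotone.functor.op.map g)
  injective _ _ g := h.injective (f.monotone.functor.map g)

theorem IsIsobisheaf.map_mem_range {F : BisheafOn.{v, w} B} (h : F.IsIsobisheaf) {V U : B}
    (f : V ⟶ U) (y : F.cosheaf.obj V) (hy : y ∈ (F.map V).hom.range) :
    (F.cosheaf.map f).hom y ∈ (F.map U).hom.range := by
  obtain ⟨z, rfl⟩ := hy
  obtain ⟨x, rfl⟩ := h.surjective f.op z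
  exact ⟨x, (congrArg (fun k => k.hom x) (F.comm f)).symm⟩

/-- The image of an isobisheaf, a local system. -/
def image (F : BisheafOn.{v, w} B) (h : F.IsIsobisheaf) : LocalSystem.{v, w} B where
  functor :=
    { obj := fun U => AddCommGrpCat.of (F.map U).hom.range
      map := fun {V U} f => AddCommGrpCat.ofHom
        (((F.cosheaf.map f).hom.comp (F.map V).hom.range.subtype).codRestrict (F.map U).hom.range
          fun y => h.map_mem_range f y.1 y.2)
      map_id := fun U => by
        ext x
        exact congrArg (fun k => k.hom x.1) (F.cosheaf.map_id U)
      map_comp := fun f g => by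
        ext x
        exact congrArg (fun k => k.hom x.1) (F.cosheaf.map_comp f g) }
  isIso {V U} f := by
    rw [ConcreteCategory.isIso_iff_bijective]
    constructor
    · intro x y hxy
      exact Subtype.ext (h.injective f (congrArg Subtype.val hxy))
    · rintro ⟨_, x, rfl⟩
      exact ⟨⟨_, ⟨(F.sheaf.map f.op).hom x, rfl⟩⟩,
        Subtype.ext (congrArg (fun k => k.hom x) (F.comm f))⟩

end BisheafOn
end Sheaves

section Constructions

namespace Bisheaf

variable {X : Type u} [TopologicalSpace X] {V : Type v}

/-- The values of a bisheaf on non-empty connected open sets. -/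
def onConn (F : Bisheaf.{u, w} X) : BisheafOn.{u, w} (ConnOpens X) where
  sheaf := (Subtype.mono_coe fun U : Opens X => IsConnected (U : Set X)).functor.op ⋙ F.sheaf
  cosheaf := (Subtype.mono_coe fun U : Opens X => IsConnected (U : Set X)).functor ⋙ F.cosheaf
  map U := F.map U
  comm f := F.comm ((Subtype.mono_coe fun U : Opens X => IsConnected (U : Set X)).functor.map f)

/-- A bisheaf is constructible with respect to a triangulation if its sheaf and its cosheaf send
inclusions of basic open sets associated to a common stratum to isomorphisms. -/
def IsConstructible (F : Bisheaf.{u, w} X) (T : Triangulation X V) : Prop :=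
  ∀ (σ : Finset V) (U' U : Opens X), T.IsBasicAt T.K openSimplex σ U' →
    T.IsBasicAt T.K openSimplex σ U → ∀ f : U' ⟶ U,
      IsIso (F.sheaf.map f.op) ∧ IsIso (F.cosheaf.map f)

/-- The values of a bisheaf on the basic open sets of a triangulation. -/
def onBasic (F : Bisheaf.{u, w} X) (T : Triangulation X V) :
    BisheafOn.{u, w} {U : Opens X // T.IsBasic U} :=
  F.onConn.pullback
    { toFun := fun U => ⟨U.1, U.2.isConnected⟩
      monotone' := fun _ _ h => h }

/-- The pull-back `Σ^* F` of a bisheaf along the dilation map, given on basic open sets `U` of the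
second subdivision by `Σ^* F (U) = F (st Σ(C))` where `U` is associated to the simplex `C`. -/
def dilate (F : Bisheaf.{u, w} X) (T : Triangulation X V) :
    BisheafOn.{u, w} {U : Opens X // T.IsDilationBasic U} :=
  F.onConn.pullback
    { toFun := fun U => ⟨⟨T.dilateSet U.1, U.2.isOpen⟩, U.2.isConnected⟩
      monotone' := fun _ _ h => Triangulation.dilateSet_mono h }

end Bisheaf

variable {M : Type u} [TopologicalSpace M] {A : Type u'} [TopologicalSpace A]

/-- Let `a : A → M` be an étale open and let `P` describe the basic open sets of a stratification of
`M`.  These are the basic open sets of the pulled-back stratification of `A` that lie in the open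
set `S` of `A`: the open sets that `a` maps homeomorphically onto a basic open set of `M`. -/
abbrev EtaleBasic (a : A → M) (ha : IsLocalHomeomorph a) (S : Set A) (P : Opens M → Prop) :
    Type u' :=
  {U : Opens A // (U : Set A) ⊆ S ∧ Set.InjOn a U ∧ P ⟨a '' U, ha.isOpenMap _ U.2⟩}

/-- The pull-back `a^* F` of a bisheaf along the étale open `a|S`: `(a^* F)(U) = F(a(U))`. -/
def BisheafOn.etalePullback {P : Opens M → Prop} (F : BisheafOn.{u, w} {U : Opens M // P U})
    (a : A → M) (ha : IsLocalHomeomorph a) (S : Set A) :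
    BisheafOn.{u', w} (EtaleBasic a ha S P) :=
  F.pullback
    { toFun := fun U => ⟨_, U.2.2.2⟩
      monotone' := fun _ _ h => Set.image_mono h }

/-- The linear extension of a map of vertices to barycentric coordinates. -/
noncomputable def linearExtension {V : Type v} {W : Type v'} (ψ : W → V) (x : W → ℝ) : V → ℝ :=
  fun v => ∑ᶠ (w : W) (_ : ψ w = v), x w

open Classical in
/-- The data `(L, ψ)` exhibits `a : A → M` as an étale open of the `m`-manifold `M` that is
constructible with respect to the triangulation `T`. -/
structure IsConstructibleEtale (m : ℕ) {V : Type v} {W : Type v'} (T : Triangulation M V)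
    (a : A → M) (L : Triangulation A W) (ψ : W → V) : Prop where
  isLocalHomeomorph : IsLocalHomeomorph a
  simplicial : ∀ s ∈ L.K, s.image ψ ∈ T.K
  comm : ∀ x, T.coord (a x) = linearExtension ψ (L.coord x)
  isFace : ∀ s ∈ L.K₀, ∃ t ∈ L.K, t ∉ L.K₀ ∧ s ⊆ t
  single : ∀ s ∈ L.K₀, s.card = m → ∃! t, t ∈ L.K ∧ t ∉ L.K₀ ∧ t.card = m + 1 ∧ s ⊆ t

/-- The étale map `μ` from the shrinking of `a` to `a`, on basic open sets. -/
def shrinkingMap {V : Type v} {W : Type v'} (T : Triangulation M V) (a : A → M)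
    (ha : IsLocalHomeomorph a) (L : Triangulation A W) :
    EtaleBasic a ha L.shrinking T.IsDilationBasic →o EtaleBasic a ha Set.univ T.IsBasic where
  toFun U := ⟨U.1, Set.subset_univ _, U.2.2.1, U.2.2.2.isBasic⟩
  monotone' _ _ h := h

end Constructions

end PersistentSheaf

/-! Both local systems are pulled back from one poset, the simplices of L - L₀ under reversed
inclusion (`SimplicialPair.Stratum`). On it lives the bisheaf s ↦ F(st ψ(s)), with a persistent
local system S.

A basic open set of A has an associated simplex of L - L₀ (`stratum`), and constructibility
identifies a^*F with the pull-back of this bisheaf along `stratum`. A basic open set of the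
shrinking has an associated simplex D of L². Send it to `lowest D`, the least member of the least
chain of D (`lowestStratum`); the shrinking consists exactly of the D with `lowest D` outside L₀
(`notMem_closedStar`). Passing to least members reverses inclusions of chains, so the largest member
of the chain Σ(C) is `lowest C`. Hence st Σ(C), taken in K¹, is a basic open set of K associated to
`lowest C`, and constructibility identifies ȧ^*Σ^*F with the pull-back of the same bisheaf along
`lowestStratum`.

For a general monotone map, a pull-back may have more sub-episheaves than those pulled back, so Iso
need not commute with it. It does along an `IsConnectedQuotient`: connected fibres force the
subgroups over one point to agree, and lifts of comparable pairs transfer the episheaf condition to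
the base. Both maps to the strata are of this kind. The two sides are therefore the pull-backs of S
along `stratum ∘ μ` and along `lowestStratum`. These maps differ, but `lowest D` is a face of the
simplex of L that carries D, so they are comparable, and S turns inclusions into isomorphisms
(`LocalSystem.isoOfLE`).

The geometry needed is that ψ is injective on simplices of L - L₀ (`injOn_vertices`), that an open
set mapped injectively onto a basic open set lies in the star of its simplex (`subset_star`,
`subset_star₂`), and that stars in the second subdivision are open (`isOpen_star₂`). -/

namespace PersistentSheaf
-- Epification, monofication and isofication under pull-back
namespace BisheafOn
variable {B : Type v} [Preorder B] {B' : Type v'} [Preorder B']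

theorem le_epiSubgroup {F : Bᵒᵖ ⥤ AddCommGrpCat.{w}} {E : ∀ U, AddSubgroup (F.obj U)}
    (hE : IsSubEpisheaf F E) (U : Bᵒᵖ) : E U ≤ epiSubgroup F U :=
  le_iSup (fun E : {E : ∀ U, AddSubgroup (F.obj U) // IsSubEpisheaf F E} => E.1 U) ⟨E, hE⟩

theorem monoKernel_le {G : B ⥤ AddCommGrpCat.{w}} {N : ∀ U, AddSubgroup (G.obj U)}
    (hN : IsMonoKernel G N) (U : B) : monoKernel G U ≤ N U :=
  iInf_le (fun N : {N : ∀ U, AddSubgroup (G.obj U) // IsMonoKernel G N} => N.1 U) ⟨N, hN⟩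

/-- Images of sub-episheaves under a natural isomorphism are sub-episheaves, and so are preimages;
maximality on each side gives one inclusion. -/
theorem map_epiSubgroup {F G : Bᵒᵖ ⥤ AddCommGrpCat.{w}} (α : F ⟶ G)
    (hα : ∀ U, Function.Bijective (α.app U).hom) (U : Bᵒᵖ) :
    (epiSubgroup F U).map (α.app U).hom = epiSubgroup G U := by
  have hnat : ∀ ⦃U V : Bᵒᵖ⦄ (f : U ⟶ V) (S : AddSubgroup (F.obj U)),
      (S.map (α.app U).hom).map (G.map f).hom = (S.map (F.map f).hom).map (α.app V).hom := by
    intro U V f S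
    rw [AddSubgroup.map_map, AddSubgroup.map_map, ← AddCommGrpCat.hom_comp,
      ← AddCommGrpCat.hom_comp, α.naturality]
  apply le_antisymm
  · refine le_epiSubgroup (E := fun U => (epiSubgroup F U).map (α.app U).hom) ?_ U
    intro U V f
    rw [hnat, epiSubgroup_isSubEpisheaf F f]
  · have h : epiSubgroup G U =
        ((epiSubgroup G U).comap (α.app U).hom).map (α.app U).hom :=
      (AddSubgroup.map_comap_eq_self_of_surjective (hα U).2 _).symm
    rw [h]
    refine AddSubgroup.map_mono
      (le_epiSubgroup (E := fun U => (epiSubgroup G U).comap (α.app U).hom) ?_ U)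
    intro U V f
    apply AddSubgroup.map_injective (hα V).1
    rw [← hnat, AddSubgroup.map_comap_eq_self_of_surjective (hα U).2,
      AddSubgroup.map_comap_eq_self_of_surjective (hα V).2, epiSubgroup_isSubEpisheaf G f]

/-- Dual to `map_epiSubgroup`: kernels of quotient-monocosheaves are transported both ways, and
minimality replaces maximality. -/
theorem comap_monoKernel {F G : B ⥤ AddCommGrpCat.{w}} (β : F ⟶ G)
    (hβ : ∀ U, Function.Bijective (β.app U).hom) (U : B) :
    (monoKernel G U).comap (β.app U).hom = monoKernel F U := by
  have hnat : ∀ ⦃V U : B⦄ (f : V ⟶ U) (S : AddSubgroup (G.obj U)),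
      (S.comap (β.app U).hom).comap (F.map f).hom = (S.comap (G.map f).hom).comap (β.app V).hom := by
    intro V U f S
    rw [AddSubgroup.comap_comap, AddSubgroup.comap_comap, ← AddCommGrpCat.hom_comp,
      ← AddCommGrpCat.hom_comp, β.naturality]
  apply le_antisymm
  · have h : monoKernel F U = ((monoKernel F U).map (β.app U).hom).comap (β.app U).hom :=
      (AddSubgroup.comap_map_eq_self_of_injective (hβ U).1 _).symm
    rw [h]
    refine AddSubgroup.comap_mono
      (monoKernel_le (N := fun U => (monoKernel F U).map (β.app U).hom) ?_ U)
    intro V U f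
    apply AddSubgroup.comap_injective (hβ V).2
    rw [← hnat, AddSubgroup.comap_map_eq_self_of_injective (hβ U).1,
      AddSubgroup.comap_map_eq_self_of_injective (hβ V).1, monoKernel_isMonoKernel F f]
  · refine monoKernel_le (N := fun U => (monoKernel G U).comap (β.app U).hom) ?_ U
    intro V U f
    rw [hnat, monoKernel_isMonoKernel G f]

/-- A monotone map along which sub-episheaves and monokernels descend: its fibres are connected, and
each comparable pair lifts. -/
structure IsConnectedQuotient (p : B' →o B) : Prop where
  fibre : ∀ x y, p x = p y → Relation.EqvGen (fun x y => x ≤ y ∧ p x = p y) x y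
  lift : ∀ b c, b ≤ c → ∃ x y, x ≤ y ∧ p x = b ∧ p y = c

/-- The relation `R` may depend on the proofs that its arguments lie over `b`, because the subgroups
to be compared are transported along these equalities. -/
theorem IsConnectedQuotient.induction {p : B' →o B} (hp : IsConnectedQuotient p)
    {b : B} {R : ∀ x y : B', p x = b → p y = b → Prop}
    (rel : ∀ x y (hx : p x = b) (hy : p y = b), x ≤ y → R x y hx hy)
    (refl : ∀ x hx, R x x hx hx) (symm : ∀ x y hx hy, R x y hx hy → R y x hy hx)
    (trans : ∀ x y z hx hy hz, R x y hx hy → R y z hy hz → R x z hx hz)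
    (x y : B') (hx : p x = b) (hy : p y = b) : R x y hx hy := by
  -- The equality `p x = p y` is carried through the induction: at a transitivity step it supplies
  -- the proof that the middle point lies in the fibre.
  have key : ∀ x y, Relation.EqvGen (fun x y => x ≤ y ∧ p x = p y) x y →
      p x = p y ∧ ∀ hx hy, R x y hx hy := by
    intro x y h
    induction h with
    | rel x y h => exact ⟨h.2, fun hx hy => rel x y hx hy h.1⟩
    | refl x => exact ⟨rfl, fun hx _ => refl x hx⟩
    | symm x y _ ih => exact ⟨ih.1.symm, fun hx hy => symm x y hy hx (ih.2 hy hx)⟩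
    | trans x y z _ _ ih1 ih2 =>
      refine ⟨ih1.1.trans ih2.1, fun hx hz => ?_⟩
      have hy := ih1.1.symm.trans hx
      exact trans x y z hx hy hz (ih1.2 hx hy) (ih2.2 hy hz)
  exact (key x y (hp.fibre x y (hx.trans hy.symm))).2 hx hy

/-- A sub-episheaf of a pull-back along a connected quotient descends. -/
theorem IsConnectedQuotient.le_epiSubgroup {p : B' →o B} (hp : IsConnectedQuotient p)
    (F : Bᵒᵖ ⥤ AddCommGrpCat.{w}) (E : ∀ x, AddSubgroup (F.obj (op (p x))))
    (hE : ∀ ⦃x y : B'⦄ (h : x ≤ y), (E y).map (F.map (homOfLE (p.monotone h)).op).hom = E x)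
    (U : B') : E U ≤ epiSubgroup F (op (p U)) := by
  have hcomp : ∀ ⦃a b c : B⦄ (h : a ≤ b) (h' : b ≤ c) (S : AddSubgroup (F.obj (op c))),
      (S.map (F.map (homOfLE h').op).hom).map (F.map (homOfLE h).op).hom =
        S.map (F.map (homOfLE (h.trans h')).op).hom := by
    intro a b c h h' S
    rw [AddSubgroup.map_map, ← AddCommGrpCat.hom_comp, ← F.map_comp]
    rfl
  have hid : ∀ ⦃a : B⦄ (h : a ≤ a) (S : AddSubgroup (F.obj (op a))),
      S.map (F.map (homOfLE h).op).hom = S := by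
    intro a h S
    have : F.map (homOfLE h).op = 𝟙 _ := F.map_id (op a)
    rw [this, AddCommGrpCat.hom_id, AddSubgroup.map_id]
  -- Transport along `p x = b` is written as a structure map of `F`, so that composition replaces
  -- dependent rewriting. For `x ≤ y` in one fibre the claim is then the episheaf condition itself,
  -- and zigzags give the rest.
  have hc : ∀ (b : B) (x y : B') (hx : p x = b) (hy : p y = b),
      (E x).map (F.map (homOfLE hx.ge).op).hom = (E y).map (F.map (homOfLE hy.ge).op).hom := by
    intro b
    refine hp.induction ?_ (fun _ _ => rfl) (fun _ _ _ _ => Eq.symm)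
      (fun _ _ _ _ _ _ => Eq.trans)
    intro x y hx hy h
    rw [← hE h, hcomp]
  -- The supremum avoids choosing a point of each fibre: all its terms agree by `hc`, so over `p x`
  -- it is just `E x`.
  let E' : ∀ b : Bᵒᵖ, AddSubgroup (F.obj b) := fun b =>
    ⨆ x : {x // p x = b.unop}, (E x.1).map (F.map (homOfLE x.2.ge).op).hom
  have hE' : ∀ x : B', E' (op (p x)) = E x := by
    intro x
    rw [← hid le_rfl (E x)]
    exact le_antisymm (iSup_le fun y => (hc (p x) y.1 x y.2 rfl).le)
      (le_iSup (fun y : {y // p y = p x} => (E y.1).map (F.map (homOfLE y.2.ge).op).hom)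
        ⟨x, rfl⟩)
  rw [← hE']
  refine BisheafOn.le_epiSubgroup ?_ _
  rintro ⟨c⟩ ⟨b⟩ f
  -- The condition for an inclusion in the base is read off from a lift of that inclusion.
  obtain ⟨x, y, hxy, rfl, rfl⟩ := hp.lift b c (leOfHom f.unop)
  rw [hE', hE']
  exact hE hxy

/-- The inclusion `≥` holds for every monotone map, since sub-episheaves pull back; `≤` is the
descent along the connected quotient. -/
theorem epiSubgroup_pullback {p : B' →o B} (hp : IsConnectedQuotient p)
    (F : Bᵒᵖ ⥤ AddCommGrpCat.{w}) (U : B') :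
    epiSubgroup (p.monotone.functor.op ⋙ F) (op U) = epiSubgroup F (op (p U)) := by
  apply le_antisymm
  · exact hp.le_epiSubgroup F (fun x => epiSubgroup (p.monotone.functor.op ⋙ F) (op x))
      (fun x y h => epiSubgroup_isSubEpisheaf (p.monotone.functor.op ⋙ F) (homOfLE h).op) U
  · refine le_epiSubgroup (F := p.monotone.functor.op ⋙ F)
      (E := fun U => epiSubgroup F (op (p U.unop))) ?_ (op U)
    intro U V f
    exact epiSubgroup_isSubEpisheaf F (p.monotone.functor.op.map f)

/-- A monokernel of a pull-back along a connected quotient descends. -/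
theorem IsConnectedQuotient.monoKernel_le {p : B' →o B} (hp : IsConnectedQuotient p)
    (F : B ⥤ AddCommGrpCat.{w}) (N : ∀ x, AddSubgroup (F.obj (p x)))
    (hN : ∀ ⦃x y : B'⦄ (h : x ≤ y), (N y).comap (F.map (homOfLE (p.monotone h))).hom = N x)
    (U : B') : monoKernel F (p U) ≤ N U := by
  have hcomp : ∀ ⦃a b c : B⦄ (h : a ≤ b) (h' : b ≤ c) (S : AddSubgroup (F.obj c)),
      (S.comap (F.map (homOfLE h')).hom).comap (F.map (homOfLE h)).hom =
        S.comap (F.map (homOfLE (h.trans h'))).hom := by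
    intro a b c h h' S
    rw [AddSubgroup.comap_comap, ← AddCommGrpCat.hom_comp, ← F.map_comp]
    rfl
  have hid : ∀ ⦃a : B⦄ (h : a ≤ a) (S : AddSubgroup (F.obj a)),
      S.comap (F.map (homOfLE h)).hom = S := by
    intro a h S
    have : F.map (homOfLE h) = 𝟙 _ := F.map_id a
    rw [this, AddCommGrpCat.hom_id, AddSubgroup.comap_id]
  have hc : ∀ (b : B) (x y : B') (hx : p x = b) (hy : p y = b),
      (N x).comap (F.map (homOfLE hx.ge)).hom = (N y).comap (F.map (homOfLE hy.ge)).hom := by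
    intro b
    refine hp.induction ?_ (fun _ _ => rfl) (fun _ _ _ _ => Eq.symm)
      (fun _ _ _ _ _ _ => Eq.trans)
    intro x y hx hy h
    rw [← hN h, hcomp]
  -- Again all members of the family over `b` coincide, so the infimum is any one of them.
  let N' : ∀ b : B, AddSubgroup (F.obj b) := fun b =>
    ⨅ x : {x // p x = b}, (N x.1).comap (F.map (homOfLE x.2.ge)).hom
  have hN' : ∀ x : B', N' (p x) = N x := by
    intro x
    rw [← hid le_rfl (N x)]
    exact le_antisymm
      (iInf_le (fun y : {y // p y = p x} => (N y.1).comap (F.map (homOfLE y.2.ge)).hom) ⟨x, rfl⟩)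
      (le_iInf fun y => (hc (p x) y.1 x y.2 rfl).ge)
  rw [← hN']
  refine BisheafOn.monoKernel_le ?_ _
  intro b c f
  obtain ⟨x, y, hxy, rfl, rfl⟩ := hp.lift b c (leOfHom f)
  rw [hN', hN']
  exact hN hxy

theorem monoKernel_pullback {p : B' →o B} (hp : IsConnectedQuotient p)
    (F : B ⥤ AddCommGrpCat.{w}) (U : B') :
    monoKernel (p.monotone.functor ⋙ F) U = monoKernel F (p U) := by
  apply le_antisymm
  · refine monoKernel_le (G := p.monotone.functor ⋙ F)
      (N := fun U => monoKernel F (p U)) ?_ U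
    intro U V f
    exact monoKernel_isMonoKernel F (p.monotone.functor.map f)
  · exact hp.monoKernel_le F (fun x => monoKernel (p.monotone.functor ⋙ F) x)
      (fun x y h => monoKernel_isMonoKernel (p.monotone.functor ⋙ F) (homOfLE h)) U

/-- An identification of a bisheaf with the pull-back of another one along a monotone map. -/
structure PullbackIso (G : BisheafOn.{v', w} B') (H : BisheafOn.{v, w} B) (p : B' →o B) where
  /-- the map of sheaves -/
  res : p.monotone.functor.op ⋙ H.sheaf ⟶ G.sheaf
  /-- the map of cosheaves -/
  ext : G.cosheaf ⟶ p.monotone.functor ⋙ H.cosheaf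
  res_bijective : ∀ U, Function.Bijective (res.app U).hom
  ext_bijective : ∀ U, Function.Bijective (ext.app U).hom
  comm : ∀ U, res.app (op U) ≫ G.map U ≫ ext.app U = H.map (p U)

namespace PullbackIso
variable {G : BisheafOn.{v', w} B'} {H : BisheafOn.{v, w} B} {p : B' →o B}

theorem monoKernel_eq (c : PullbackIso G H p) (hp : IsConnectedQuotient p) (U : B') :
    (monoKernel H.cosheaf (p U)).comap (c.ext.app U).hom = monoKernel G.cosheaf U := by
  rw [← comap_monoKernel c.ext c.ext_bijective U, monoKernel_pullback hp]

theorem epiSubgroup_eq (c : PullbackIso G H p) (hp : IsConnectedQuotient p) (U : B') :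
    (epiSubgroup H.sheaf (op (p U))).map (c.res.app (op U)).hom =
      epiSubgroup G.sheaf (op U) := by
  rw [← map_epiSubgroup c.res c.res_bijective (op U), epiSubgroup_pullback hp]

/-- The map of monofications that `ext` induces. -/
def monoMap (c : PullbackIso G H p) (hp : IsConnectedQuotient p) (U : B') :
    (G.cosheaf.obj U ⧸ monoKernel G.cosheaf U) →+
      (H.cosheaf.obj (p U) ⧸ monoKernel H.cosheaf (p U)) :=
  QuotientAddGroup.map _ _ (c.ext.app U).hom (c.monoKernel_eq hp U).ge

theorem monoMap_injective (c : PullbackIso G H p) (hp : IsConnectedQuotient p) (U : B') :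
    Function.Injective (c.monoMap hp U) := by
  refine (injective_iff_map_eq_zero _).2 fun x hx => ?_
  obtain ⟨x, rfl⟩ := QuotientAddGroup.mk_surjective x
  refine (QuotientAddGroup.eq_zero_iff x).2 ?_
  rw [← c.monoKernel_eq hp U]
  have hx' : QuotientAddGroup.mk' (monoKernel H.cosheaf (p U)) ((c.ext.app U).hom x) = 0 := hx
  exact (QuotientAddGroup.eq_zero_iff (G := H.cosheaf.obj (p U)) _).1 hx'

/-- The map of `H` factors as `ext ∘ G.map ∘ res`, and `res` carries the epification of `H` onto
that of `G`; hence the two images match inside the monofication of `H`. -/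
theorem map_range (c : PullbackIso G H p) (hp : IsConnectedQuotient p) (U : B') :
    (G.iso.map U).hom.range.map (c.monoMap hp U) = (H.iso.map (p U)).hom.range := by
  have hcomm : ∀ z : H.sheaf.obj (op (p U)), @Eq (H.cosheaf.obj (p U))
      ((c.ext.app U).hom ((G.map U).hom ((c.res.app (op U)).hom z))) ((H.map (p U)).hom z) :=
    fun z => congrArg (fun k => k.hom z) (c.comm U)
  ext y
  constructor
  · rintro ⟨_, ⟨⟨e, he⟩, rfl⟩, rfl⟩
    obtain ⟨e, he', rfl⟩ := (c.epiSubgroup_eq hp U).ge he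
    exact ⟨⟨e, he'⟩,
      congrArg (QuotientAddGroup.mk' (monoKernel H.cosheaf (p U))) (hcomm e).symm⟩
  · rintro ⟨⟨e, he⟩, rfl⟩
    exact ⟨_, ⟨⟨(c.res.app (op U)).hom e, (c.epiSubgroup_eq hp U).le ⟨e, he, rfl⟩⟩, rfl⟩,
      congrArg (QuotientAddGroup.mk' (monoKernel H.cosheaf (p U))) (hcomm e)⟩

/-- The persistent local system of a pull-back along a connected quotient is the pull-back of the
persistent local system. -/
noncomputable def imageIso (c : PullbackIso G H p) (hp : IsConnectedQuotient p) :
    (G.iso.image (isIsobisheaf_iso G)).functor ≅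
      p.monotone.functor ⋙ (H.iso.image (isIsobisheaf_iso H)).functor :=
  NatIso.ofComponents
    (fun U => AddEquiv.toAddCommGrpIso (X := AddCommGrpCat.of (G.iso.map U).hom.range)
      (Y := AddCommGrpCat.of (H.iso.map (p U)).hom.range)
      (((G.iso.map U).hom.range.equivMapOfInjective _ (c.monoMap_injective hp U)).trans
        (AddEquiv.addSubgroupCongr (c.map_range hp U))))
    (by
      intro U V f
      ext ⟨y, hy⟩
      apply Subtype.ext
      obtain ⟨x, rfl⟩ := QuotientAddGroup.mk_surjective y
      exact congrArg (QuotientAddGroup.mk' (monoKernel H.cosheaf (p V)))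
        (congrArg (fun k => k.hom x) (c.ext.naturality f)))

end PullbackIso

end BisheafOn

/-- Pull-backs of a local system along comparable monotone maps are isomorphic. -/
noncomputable def LocalSystem.isoOfLE {B : Type v} [Preorder B] {B' : Type v'}
    [Preorder B'] (S : LocalSystem.{v, w} B) {p q : B' →o B} (h : ∀ U, p U ≤ q U) :
    p.monotone.functor ⋙ S.functor ≅ q.monotone.functor ⋙ S.functor :=
  NatIso.ofComponents
    (fun U => @asIso _ _ _ _ (S.functor.map (homOfLE (h U))) (S.isIso (homOfLE (h U))))
    (by
      intro U V f
      change S.functor.map _ ≫ S.functor.map _ = S.functor.map _ ≫ S.functor.map _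
      rw [← S.functor.map_comp, ← S.functor.map_comp]
      rfl)

/-! ### Simplicial maps and their action on iterated subdivisions -/

section Push
variable {I : Type v} {J : Type v'}

open Classical in
/-- The image of a simplex under a map of vertices. -/
noncomputable def push (f : I → J) (s : Finset I) : Finset J := s.image f

variable {f : I → J}

theorem mem_push {s : Finset I} {j : J} : j ∈ push f s ↔ ∃ i ∈ s, f i = j := by
  classical
  exact Finset.mem_image

theorem mem_push_of_mem {s : Finset I} {i : I} (hi : i ∈ s) : f i ∈ push f s :=
  mem_push.2 ⟨i, hi, rfl⟩

theorem push_subset {s t : Finset I} (h : s ⊆ t) : push f s ⊆ push f t := by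
  classical
  exact Finset.image_subset_image h

theorem card_push {s : Finset I} (h : Set.InjOn f s) : (push f s).card = s.card := by
  classical
  exact Finset.card_image_of_injOn h

theorem push_nonempty {s : Finset I} (h : s.Nonempty) : (push f s).Nonempty := by
  classical
  exact h.image f

theorem subset_of_push_subset {r s t : Finset I} (h : Set.InjOn f r) (hs : s ⊆ r) (ht : t ⊆ r)
    (hst : push f s ⊆ push f t) : s ⊆ t := by
  intro i hi
  obtain ⟨j, hj, hij⟩ := mem_push.1 (hst (mem_push_of_mem hi))
  exact h (ht hj) (hs hi) hij ▸ hj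

theorem injOn_push {r : Finset I} (h : Set.InjOn f r) {c : Finset (Finset I)}
    (hc : ∀ σ ∈ c, σ ⊆ r) : Set.InjOn (push f) (c : Set (Finset I)) := fun σ hσ τ hτ e =>
  (subset_of_push_subset h (hc σ hσ) (hc τ hτ) e.le).antisymm
    (subset_of_push_subset h (hc τ hτ) (hc σ hσ) e.ge)

theorem push_mem_sd {K : PreAbstractSimplicialComplex I} {K' : PreAbstractSimplicialComplex J}
    (h : ∀ s ∈ K, push f s ∈ K') {c : Finset (Finset I)} (hc : c ∈ sd K) :
    push (push f) c ∈ sd K' := by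
  refine ⟨push_nonempty hc.1, fun σ hσ => ?_, fun σ hσ τ hτ _ => ?_⟩
  · obtain ⟨s, hs, rfl⟩ := mem_push.1 hσ
    exact h s (hc.2.1 s hs)
  · obtain ⟨s, hs, rfl⟩ := mem_push.1 (Finset.mem_coe.1 hσ)
    obtain ⟨t, ht, rfl⟩ := mem_push.1 (Finset.mem_coe.1 hτ)
    exact (hc.2.2.total hs ht).imp push_subset push_subset

theorem dilationVertex_eq {c : Finset (Finset I)} (hc : IsChain (· ⊆ ·) (c : Set (Finset I)))
    {σ : Finset I} (hσ : σ ∈ c) (h : ∀ τ ∈ c, σ ⊆ τ) : dilationVertex c = σ := by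
  obtain ⟨h1, h2⟩ := dilationVertex_mem ⟨σ, hσ⟩ hc
  exact (h2 σ hσ).antisymm (h _ h1)

/-- Taking images preserves inclusions, so the least member goes to the least member, even if `f`
collapses vertices. -/
theorem dilationVertex_push {K : PreAbstractSimplicialComplex I} {c : Finset (Finset I)}
    (hc : c ∈ sd K) : dilationVertex (push (push f) c) = push f (dilationVertex c) := by
  obtain ⟨h1, h2⟩ := dilationVertex_mem hc.1 hc.2.2
  refine dilationVertex_eq ?_ (mem_push_of_mem h1) fun τ hτ => ?_
  · intro σ hσ τ hτ _
    obtain ⟨s, hs, rfl⟩ := mem_push.1 (Finset.mem_coe.1 hσ)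
    obtain ⟨t, ht, rfl⟩ := mem_push.1 (Finset.mem_coe.1 hτ)
    exact (hc.2.2.total hs ht).imp push_subset push_subset
  · obtain ⟨t, ht, rfl⟩ := mem_push.1 hτ
    exact push_subset (h2 t ht)

open Classical in
theorem linearExtension_apply {s : Finset I} {x : I → ℝ} (hx : ∀ i ∉ s, x i = 0) (j : J) :
    linearExtension f x j = ∑ i ∈ s, if f i = j then x i else 0 := by
  rw [linearExtension]
  have h : ∀ i, (∑ᶠ (_ : f i = j), x i) = if f i = j then x i else 0 := fun i => finsum_eq_if
  simp_rw [h]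
  refine finsum_eq_sum_of_support_subset _ fun i hi => ?_
  by_contra hc
  apply hi
  simp [hx i hc]

theorem linearExtension_mem_openSimplex {s : Finset I} {x : I → ℝ} (hx : x ∈ openSimplex s) :
    linearExtension f x ∈ openSimplex (push f s) := by
  classical
  obtain ⟨hpos, hzero, hsum⟩ := hx
  refine ⟨fun j hj => ?_, fun j hj => ?_, ?_⟩
  · obtain ⟨i, hi, rfl⟩ := mem_push.1 hj
    rw [linearExtension_apply hzero]
    refine Finset.sum_pos' (fun k hk => ?_) ⟨i, hi, ?_⟩
    · split_ifs
      · exact (hpos k hk).le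
      · exact le_rfl
    · rw [if_pos rfl]
      exact hpos i hi
  · rw [linearExtension_apply hzero]
    refine Finset.sum_eq_zero fun i hi => if_neg ?_
    rintro rfl
    exact hj (mem_push_of_mem hi)
  · simp_rw [linearExtension_apply hzero]
    rw [Finset.sum_comm, ← hsum]
    refine Finset.sum_congr rfl fun i hi => ?_
    rw [Finset.sum_ite_eq, if_pos (mem_push_of_mem hi)]

theorem linearExtension_add_smul {s : Finset I} {x y : I → ℝ} (hx : ∀ i ∉ s, x i = 0)
    (hy : ∀ i ∉ s, y i = 0) (a b : ℝ) :
    linearExtension f (a • x + b • y) = a • linearExtension f x + b • linearExtension f y := by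
  classical
  funext j
  rw [linearExtension_apply (s := s) (fun i hi => by simp [hx i hi, hy i hi])]
  simp only [Pi.add_apply, Pi.smul_apply, smul_eq_mul]
  rw [linearExtension_apply hx, linearExtension_apply hy, Finset.mul_sum, Finset.mul_sum,
    ← Finset.sum_add_distrib]
  refine Finset.sum_congr rfl fun i _ => ?_
  split_ifs <;> ring

theorem sdMap_add_smul {c : Finset (Finset I)} {x y : Finset I → ℝ} (hx : ∀ i ∉ c, x i = 0)
    (hy : ∀ i ∉ c, y i = 0) (a b : ℝ) :
    sdMap (a • x + b • y) = a • sdMap x + b • sdMap y := by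
  classical
  funext j
  rw [sdMap_apply (c := c) (fun i hi => by simp [hx i hi, hy i hi])]
  simp only [Pi.add_apply, Pi.smul_apply, smul_eq_mul]
  rw [sdMap_apply hx, sdMap_apply hy, Finset.mul_sum, Finset.mul_sum, ← Finset.sum_add_distrib]
  refine Finset.sum_congr rfl fun i _ => ?_
  split_ifs <;> ring

/-- A linear extension sends barycenters to barycenters provided that no two vertices of a simplex
are identified; injectivity on a common simplex `r` is what makes it compatible with subdivision. -/
theorem linearExtension_sdMap {r : Finset I} (h : Set.InjOn f r) {c : Finset (Finset I)}
    (hc : ∀ σ ∈ c, σ ⊆ r) {g : Finset I → ℝ} (hg : ∀ σ ∉ c, g σ = 0) :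
    linearExtension f (sdMap g) = sdMap (linearExtension (push f) g) := by
  classical
  funext j
  have h1 : ∀ i ∉ r, sdMap g i = 0 := fun i hi => by
    rw [sdMap_apply hg]
    exact Finset.sum_eq_zero fun σ hσ => if_neg fun h => hi (hc σ hσ h)
  have h2 : ∀ τ ∉ push (push f) c, linearExtension (push f) g τ = 0 := fun τ hτ => by
    rw [linearExtension_apply hg]
    refine Finset.sum_eq_zero fun σ hσ => if_neg ?_
    rintro rfl
    exact hτ (mem_push_of_mem hσ)
  rw [linearExtension_apply h1, sdMap_apply h2]
  have h3 : ∀ i, (if f i = j then sdMap g i else 0) =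
      ∑ σ ∈ c, if f i = j ∧ i ∈ σ then g σ / (σ.card : ℝ) else 0 := by
    intro i
    rw [sdMap_apply hg]
    by_cases hij : f i = j
    · simp [hij]
    · simp [hij]
  have h4 : ∀ τ, (if j ∈ τ then linearExtension (push f) g τ / (τ.card : ℝ) else 0) =
      ∑ σ ∈ c, if push f σ = τ then (if j ∈ τ then g σ / (τ.card : ℝ) else 0) else 0 := by
    intro τ
    rw [linearExtension_apply hg]
    by_cases hj : j ∈ τ
    · simp only [hj, if_true, Finset.sum_div]
      refine Finset.sum_congr rfl fun σ _ => ?_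
      split_ifs <;> simp
    · simp [hj]
  simp_rw [h3, h4]
  -- With the sum over `σ ∈ c` outermost on both sides, the contributions of each `σ` can be
  -- compared separately.
  rw [Finset.sum_comm, Finset.sum_comm (s := push (push f) c)]
  refine Finset.sum_congr rfl fun σ hσ => ?_
  rw [Finset.sum_ite_eq, if_pos (mem_push_of_mem hσ), card_push (h.mono (hc σ hσ))]
  by_cases hj : j ∈ push f σ
  · obtain ⟨i, hi, rfl⟩ := mem_push.1 hj
    -- By injectivity exactly one vertex of `σ` lies over `j`.
    rw [if_pos hj, Finset.sum_eq_single_of_mem i (hc σ hσ hi), if_pos ⟨rfl, hi⟩]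
    intro k hk hki
    exact if_neg fun e => hki (h hk (hc σ hσ hi) e.1)
  · rw [if_neg hj]
    refine Finset.sum_eq_zero fun i _ => if_neg ?_
    rintro ⟨rfl, hi⟩
    exact hj (mem_push_of_mem hi)

/-- The simplices of `K` that occur in a simplex of the second subdivision lie in a largest one, the
simplex of `K` whose interior contains the cell. -/
theorem exists_carrier {K : PreAbstractSimplicialComplex I} {C : Finset (Finset (Finset I))}
    (hC : C ∈ sd (sd K)) : ∃ c ∈ C, (∀ d ∈ C, d ⊆ c) ∧ ∃ σ ∈ c, (∀ τ ∈ c, τ ⊆ σ) ∧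
      cell₂ C ⊆ openSimplex σ := by
  obtain ⟨c, hc, htop⟩ := exists_top hC
  obtain ⟨σ, hσ, htop'⟩ := exists_top (hC.2.1 c hc)
  refine ⟨c, hc, htop, σ, hσ, htop', ?_⟩
  rintro _ ⟨_, ⟨f, hf, rfl⟩, rfl⟩
  exact sdMap_mem_openSimplex (hC.2.1 c hc) hσ htop' (sdMap_mem_openSimplex hC hc htop hf)

theorem subset_of_mem_cell₂ {K : PreAbstractSimplicialComplex I} {C : Finset (Finset (Finset I))}
    (hC : C ∈ sd (sd K)) {x : I → ℝ} (hx : x ∈ cell₂ C) {r : Finset I} (hr : x ∈ openSimplex r)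
    {c : Finset (Finset I)} (hc : c ∈ C) {σ : Finset I} (hσ : σ ∈ c) : σ ⊆ r := by
  obtain ⟨d, -, h1, τ, -, h2, h3⟩ := exists_carrier hC
  rw [← openSimplex_inj (h3 hx) hr]
  exact h2 σ (h1 c hc hσ)

theorem linearExtension_mem_cell₂ {K : PreAbstractSimplicialComplex I} {r : Finset I}
    (h : Set.InjOn f r) {C : Finset (Finset (Finset I))} (hC : C ∈ sd (sd K)) {x : I → ℝ}
    (hr : x ∈ openSimplex r) (hx : x ∈ cell₂ C) :
    linearExtension f x ∈ cell₂ (push (push (push f)) C) := by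
  have hCr : ∀ c ∈ C, ∀ σ ∈ c, σ ⊆ r := fun c hc σ hσ => subset_of_mem_cell₂ hC hx hr hc hσ
  obtain ⟨_, ⟨g, hg, rfl⟩, rfl⟩ := hx
  obtain ⟨c, hc, htop⟩ := exists_top hC
  rw [linearExtension_sdMap h (hCr c hc) (sdMap_mem_openSimplex hC hc htop hg).2.1,
    linearExtension_sdMap (injOn_push h (hCr c hc)) htop hg.2.1]
  exact ⟨_, ⟨_, linearExtension_mem_openSimplex hg, rfl⟩, rfl⟩

theorem convex_openSimplex {c d : Finset I} (hcd : c ⊆ d) {x y : I → ℝ} (hx : x ∈ openSimplex c)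
    (hy : y ∈ openSimplex d) {a b : ℝ} (ha : 0 ≤ a) (hb : 0 < b) (hab : a + b = 1) :
    a • x + b • y ∈ openSimplex d := by
  obtain ⟨f1, f2, f3⟩ := hx
  obtain ⟨g1, g2, g3⟩ := hy
  have f0 : ∀ i, 0 ≤ x i := fun i => by
    by_cases h : i ∈ c
    · exact (f1 i h).le
    · rw [f2 i h]
  have f3' : ∑ i ∈ d, x i = 1 := by
    rw [← f3]
    exact (Finset.sum_subset hcd fun i _ h => f2 i h).symm
  refine ⟨fun i hi => ?_, fun i hi => ?_, ?_⟩
  · exact add_pos_of_nonneg_of_pos (mul_nonneg ha (f0 i)) (mul_pos hb (g1 i hi))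
  · simp [f2 i fun h => hi (hcd h), g2 i hi]
  · simp [Finset.sum_add_distrib, ← Finset.mul_sum, f3', g3, hab]

theorem convex_cell₂ {K : PreAbstractSimplicialComplex I} {C D : Finset (Finset (Finset I))}
    (hD : D ∈ sd (sd K)) (hCD : C ⊆ D) {x y : I → ℝ} (hx : x ∈ cell₂ C) (hy : y ∈ cell₂ D)
    {a b : ℝ} (ha : 0 ≤ a) (hb : 0 < b) (hab : a + b = 1) : a • x + b • y ∈ cell₂ D := by
  obtain ⟨x, hx, rfl⟩ := hx
  obtain ⟨y, hy, rfl⟩ := hy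
  refine ⟨_, convex_cell₁ hCD hx hy ha hb hab, ?_⟩
  obtain ⟨d, hd, htop⟩ := exists_top hD
  obtain ⟨f, hf, rfl⟩ := hx
  obtain ⟨g, hg, rfl⟩ := hy
  refine sdMap_add_smul (c := d) (fun σ hσ => ?_) (sdMap_mem_openSimplex hD hd htop hg).2.1 a b
  classical
  rw [sdMap_apply hf.2.1]
  exact Finset.sum_eq_zero fun τ hτ => if_neg fun h => hσ (htop τ (hCD hτ) h)

theorem openSimplex_nonempty {s : Finset I} (hs : s.Nonempty) : (openSimplex s).Nonempty := by
  classical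
  refine ⟨fun i => if i ∈ s then (s.card : ℝ)⁻¹ else 0, fun i hi => ?_, fun i hi => ?_, ?_⟩
  · simp only [if_pos hi]
    exact inv_pos.2 (by exact_mod_cast Finset.card_pos.2 hs)
  · simp only [if_neg hi]
  · rw [Finset.sum_congr rfl fun i hi => if_pos hi, Finset.sum_const, nsmul_eq_mul]
    exact mul_inv_cancel₀ (by exact_mod_cast (Finset.card_pos.2 hs).ne')

theorem cell₁_nonempty {c : Finset (Finset I)} (hc : c.Nonempty) : (cell₁ c).Nonempty :=
  (openSimplex_nonempty hc).image _

theorem cell₂_nonempty {C : Finset (Finset (Finset I))} (hC : C.Nonempty) : (cell₂ C).Nonempty :=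
  ((openSimplex_nonempty hC).image _).image _

end Push

/-! ### A Lipschitz estimate for barycentric coordinates in the first subdivision -/

section Subdivision
variable {V : Type v}

/-- With x = `sdMap f`, the number f(σ)/|σ| is the gap between the least coordinate of x on σ and
its largest coordinate off σ (or 0 if that is larger), cut off below at 0. This is the upper bound
by the gap; `exists_sdMap_le` shows that the bound is attained. -/
theorem div_card_le_sdMap {K : PreAbstractSimplicialComplex V} {c : Finset (Finset V)}
    (hc : c ∈ sd K) {f : Finset V → ℝ} (hf : f ∈ openSimplex c) {σ : Finset V} (hσ : σ ∈ c)
    {v : V} (hv : v ∈ σ) :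
    f σ / (σ.card : ℝ) ≤ sdMap f v ∧ ∀ w ∉ σ, f σ / (σ.card : ℝ) + sdMap f w ≤ sdMap f v := by
  classical
  have h0 : ∀ τ ∈ c, 0 ≤ f τ / (τ.card : ℝ) := fun τ hτ =>
    div_nonneg (hf.1 τ hτ).le (Nat.cast_nonneg _)
  constructor
  · rw [sdMap_apply hf.2.1]
    have := Finset.single_le_sum (f := fun τ => if v ∈ τ then f τ / (τ.card : ℝ) else 0)
      (fun τ hτ => by split_ifs; exacts [h0 τ hτ, le_rfl]) hσ
    simpa [hv] using this
  · intro w hw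
    rw [← le_sub_iff_add_le, sdMap_apply hf.2.1, sdMap_apply hf.2.1, ← Finset.sum_sub_distrib]
    have := Finset.single_le_sum (f := fun τ => (if v ∈ τ then f τ / (τ.card : ℝ) else 0) -
      if w ∈ τ then f τ / (τ.card : ℝ) else 0) (fun τ hτ => ?_) hσ
    · simpa [hv, hw] using this
    · by_cases hwτ : w ∈ τ
      · rcases hc.2.2.total hσ hτ with h | h
        · simp [hwτ, h hv]
        · exact absurd (h hwτ) hw
      · simp only [hwτ, if_false, sub_zero]
        split_ifs
        exacts [h0 τ hτ, le_rfl]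

theorem exists_sdMap_le {K : PreAbstractSimplicialComplex V} {c : Finset (Finset V)}
    (hc : c ∈ sd K) {f : Finset V → ℝ} (hf : f ∈ openSimplex c) {σ : Finset V}
    (hne : σ.Nonempty) :
    ∃ v ∈ σ, sdMap f v ≤ f σ / (σ.card : ℝ) ∨
      ∃ w ∉ σ, sdMap f v ≤ f σ / (σ.card : ℝ) + sdMap f w := by
  classical
  by_cases hσc : σ ∈ c
  · have h0 : ∀ τ ∈ c, 0 ≤ f τ / (τ.card : ℝ) := fun τ hτ =>
      div_nonneg (hf.1 τ hτ).le (Nat.cast_nonneg _)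
    -- The least coordinate on `σ` occurs at a vertex outside the next smaller member of the chain.
    have hv : ∃ v ∈ σ, ∀ τ ∈ c, v ∈ τ → σ ⊆ τ := by
      by_cases hemp : (c.filter (· ⊂ σ)).Nonempty
      · obtain ⟨ρ, hρ, hρmax⟩ := Finset.exists_max_image (c.filter (· ⊂ σ)) Finset.card hemp
        obtain ⟨hρc, hρσ⟩ := Finset.mem_filter.1 hρ
        obtain ⟨v, hv, hvρ⟩ := Finset.exists_of_ssubset hρσ
        refine ⟨v, hv, fun τ hτ hvτ => ?_⟩
        by_contra hn
        have hτσ : τ ⊂ σ := ⟨(hc.2.2.total hσc hτ).resolve_left hn, hn⟩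
        rcases hc.2.2.total hτ hρc with h1 | h1
        · exact hvρ (h1 hvτ)
        · have := Finset.eq_of_subset_of_card_le h1 (hρmax τ (Finset.mem_filter.2 ⟨hτ, hτσ⟩))
          exact hvρ (this ▸ hvτ)
      · obtain ⟨v, hv⟩ := hne
        refine ⟨v, hv, fun τ hτ _ => ?_⟩
        by_contra hn
        exact hemp ⟨τ, Finset.mem_filter.2 ⟨hτ, (hc.2.2.total hσc hτ).resolve_left hn, hn⟩⟩
    obtain ⟨v, hvσ, hv⟩ := hv
    refine ⟨v, hvσ, ?_⟩
    have hdec : f σ / (σ.card : ℝ) = ∑ τ ∈ c, if τ = σ then f τ / (τ.card : ℝ) else 0 := by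
      rw [Finset.sum_ite_eq', if_pos hσc]
    -- The largest coordinate off `σ` occurs at a vertex `w` that the next larger member adds. If
    -- there is no larger member, `σ` is the top of the chain and the coordinate at `v` is bounded
    -- by the term of `σ` alone.
    by_cases hemp : (c.filter (σ ⊂ ·)).Nonempty
    · obtain ⟨ρ, hρ, hρmin⟩ := Finset.exists_min_image (c.filter (σ ⊂ ·)) Finset.card hemp
      obtain ⟨hρc, hσρ⟩ := Finset.mem_filter.1 hρ
      obtain ⟨w, hwρ, hwσ⟩ := Finset.exists_of_ssubset hσρ
      refine Or.inr ⟨w, hwσ, ?_⟩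
      rw [hdec, sdMap_apply hf.2.1, sdMap_apply hf.2.1, ← Finset.sum_add_distrib]
      refine Finset.sum_le_sum fun τ hτ => ?_
      by_cases hvτ : v ∈ τ
      · by_cases hτσ : τ = σ
        · subst hτσ
          simp [hvτ, hwσ]
        · have hστ : σ ⊂ τ := (hv τ hτ hvτ).ssubset_of_ne (Ne.symm hτσ)
          have hwτ : w ∈ τ := by
            rcases hc.2.2.total hρc hτ with h1 | h1
            · exact h1 hwρ
            · rw [Finset.eq_of_subset_of_card_le h1 (hρmin τ (Finset.mem_filter.2 ⟨hτ, hστ⟩))]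
              exact hwρ
          simp [hvτ, hτσ, hwτ]
      · rw [if_neg hvτ]
        refine add_nonneg ?_ ?_ <;> · split_ifs; exacts [h0 τ hτ, le_rfl]
    · refine Or.inl ?_
      rw [hdec, sdMap_apply hf.2.1]
      refine Finset.sum_le_sum fun τ hτ => ?_
      by_cases hvτ : v ∈ τ
      · have hτσ : τ = σ := by
          by_contra hn
          exact hemp ⟨τ, Finset.mem_filter.2 ⟨hτ, (hv τ hτ hvτ).ssubset_of_ne (Ne.symm hn)⟩⟩
        rw [if_pos hvτ, if_pos hτσ]
      · rw [if_neg hvτ]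
        split_ifs
        exacts [h0 τ hτ, le_rfl]
  · rw [hf.2.1 σ hσc, zero_div]
    -- If `σ` is not in the chain, a positive gap would put it there.
    by_contra! hn
    refine hσc (mem_of_lt_of_mem_cell₁ hc ⟨f, hf, rfl⟩ hne fun v hv => ?_)
    exact ⟨(hn v hv).1, fun w hw => by simpa using (hn v hv).2 w hw⟩

theorem nonneg_of_mem_openSimplex {I : Type w} {s : Finset I} {x : I → ℝ} (hx : x ∈ openSimplex s)
    (i : I) : 0 ≤ x i := by
  by_cases h : i ∈ s
  · exact (hx.1 i h).le
  · rw [hx.2.1 i h]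

/-- The gap is a difference of two coordinates, each of which moves by at most `δ`; hence the factor
2. -/
theorem div_card_le_add {K : PreAbstractSimplicialComplex V} {c d : Finset (Finset V)}
    (hc : c ∈ sd K) (hd : d ∈ sd K) {f g : Finset V → ℝ} (hf : f ∈ openSimplex c)
    (hg : g ∈ openSimplex d) {δ : ℝ} (hδ : ∀ v, |sdMap g v - sdMap f v| ≤ δ) {σ : Finset V}
    (hne : σ.Nonempty) : g σ / (σ.card : ℝ) ≤ f σ / (σ.card : ℝ) + 2 * δ := by
  have hδ0 : 0 ≤ δ := (abs_nonneg _).trans (hδ hne.choose)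
  by_cases hσ : σ ∈ d
  · obtain ⟨v, hv, h⟩ := exists_sdMap_le hc hf hne
    obtain ⟨h1, h2⟩ := div_card_le_sdMap hd hg hσ hv
    have hv' := abs_le.1 (hδ v)
    rcases h with h | ⟨w, hw, h⟩
    · linarith
    · have hw' := abs_le.1 (hδ w)
      have := h2 w hw
      linarith
  · rw [hg.2.1 σ hσ, zero_div]
    have := div_nonneg (nonneg_of_mem_openSimplex hf σ) (Nat.cast_nonneg (α := ℝ) σ.card)
    linarith

end Subdivision

/-! ### Continuity of subdivided coordinates and openness of stars -/

namespace Triangulation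
variable {X : Type u} [TopologicalSpace X] {V : Type v} (T : Triangulation X V)

theorem continuous_coord_apply (v : V) : Continuous fun y => T.coord y v :=
  (continuous_apply v).comp T.isEmbedding_coord.continuous

theorem coord_injective : Function.Injective T.coord := T.isEmbedding_coord.injective

theorem coord_nonneg (x : X) (v : V) : 0 ≤ T.coord x v := by
  obtain ⟨s, -, -, hs⟩ := T.coord_mem x
  exact nonneg_of_mem_openSimplex hs v

/-- The topology is only that of pointwise convergence, but the coordinates are non-negative with
sum 1. The mass outside the support `s` of `x` is therefore what the finitely many coordinates in
`s` lose, which bounds all coordinates uniformly. -/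
theorem eventually_abs_coord_sub_le (x : X) {δ : ℝ} (hδ : 0 < δ) :
    ∀ᶠ y in nhds x, ∀ v, |T.coord y v - T.coord x v| ≤ δ := by
  classical
  obtain ⟨s, -, -, hs⟩ := T.coord_mem x
  have hcont : Continuous fun y => ∑ u ∈ s, |T.coord y u - T.coord x u| :=
    continuous_finsetSum _ fun u _ => ((T.continuous_coord_apply u).sub continuous_const).abs
  have hlt := hcont.continuousAt.eventually_lt (x₀ := x) (continuousAt_const (y := δ)) (by simpa)
  filter_upwards [hlt] with y hy v
  by_cases hv : v ∈ s
  · exact (Finset.single_le_sum (f := fun u => |T.coord y u - T.coord x u|)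
      (fun u _ => abs_nonneg _) hv).trans hy.le
  · rw [hs.2.1 v hv, sub_zero, abs_of_nonneg (T.coord_nonneg y v)]
    obtain ⟨t, -, -, ht⟩ := T.coord_mem y
    have h4 : ∑ u ∈ insert v s, T.coord y u ≤ 1 := by
      rw [← ht.2.2]
      calc ∑ u ∈ insert v s, T.coord y u ≤ ∑ u ∈ insert v s ∪ t, T.coord y u :=
            Finset.sum_le_sum_of_subset_of_nonneg Finset.subset_union_left
              fun u _ _ => T.coord_nonneg y u
        _ = ∑ u ∈ t, T.coord y u :=
            (Finset.sum_subset Finset.subset_union_right fun u _ hu => ht.2.1 u hu).symm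
    rw [Finset.sum_insert hv] at h4
    have h5 : 1 - ∑ u ∈ s, T.coord y u ≤ ∑ u ∈ s, |T.coord y u - T.coord x u| := by
      rw [← hs.2.2, ← Finset.sum_sub_distrib]
      exact Finset.sum_le_sum fun u _ => (neg_sub (T.coord y u) _).symm.trans_le (neg_le_abs _)
    linarith

/-- The barycentric coordinates of a point with respect to the first subdivision. -/
noncomputable def sdCoord (x : X) : Finset V → ℝ := (T.exists_star₁ x).choose_spec.2.choose

theorem sdCoord_spec (x : X) :
    ∃ c ∈ sd T.K, T.sdCoord x ∈ openSimplex c ∧ sdMap (T.sdCoord x) = T.coord x :=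
  ⟨_, (T.exists_star₁ x).choose_spec.1, (T.exists_star₁ x).choose_spec.2.choose_spec⟩

theorem continuous_sdCoord_apply (σ : Finset V) : Continuous fun x => T.sdCoord x σ := by
  rcases σ.eq_empty_or_nonempty with rfl | hne
  · have : (fun x => T.sdCoord x ∅) = fun _ => 0 := by
      funext x
      obtain ⟨c, hc, hf, -⟩ := T.sdCoord_spec x
      exact hf.2.1 _ fun h => Finset.not_nonempty_empty (mem_nonempty (hc.2.1 _ h))
    rw [this]
    exact continuous_const
  · have hcard : 0 < (σ.card : ℝ) := by exact_mod_cast Finset.card_pos.2 hne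
    have hdiv : Continuous fun x => T.sdCoord x σ / (σ.card : ℝ) := by
      refine continuous_iff_continuousAt.2 fun x => Metric.tendsto_nhds.2 fun ε hε => ?_
      -- The Lipschitz factor 2 turns `ε / 4` into `ε / 2`, which is strictly less than `ε`.
      filter_upwards [T.eventually_abs_coord_sub_le x (δ := ε / 4) (by positivity)] with y hy
      obtain ⟨c, hc, hf, hfx⟩ := T.sdCoord_spec x
      obtain ⟨d, hd, hg, hgy⟩ := T.sdCoord_spec y
      rw [← hfx, ← hgy] at hy
      have h1 := div_card_le_add hc hd hf hg hy hne
      have h2 := div_card_le_add hd hc hg hf (fun v => by rw [abs_sub_comm]; exact hy v) hne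
      rw [Real.dist_eq, abs_lt]
      constructor <;> linarith
    simpa [div_mul_cancel₀ _ hcard.ne'] using hdiv.mul_const (σ.card : ℝ)

/-- The union, over the cells of a subdivision `J` that have `c` as a face. -/
def cellStar {I : Type w} (J : PreAbstractSimplicialComplex I) (cell : Finset I → Set (V → ℝ))
    (c : Finset I) : Set X :=
  {x | ∃ d ∈ J, c ⊆ d ∧ T.coord x ∈ cell d}

theorem isOpen_star (s : Finset V) : IsOpen (T.cellStar T.K openSimplex s) := by
  have : T.cellStar T.K openSimplex s = ⋂ v ∈ s, {x | 0 < T.coord x v} := by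
    ext x
    simp only [Set.mem_iInter, Set.mem_ofPred_eq]
    constructor
    · rintro ⟨t, -, hst, ht⟩ v hv
      exact ht.1 v (hst hv)
    · intro hx
      obtain ⟨t, ht, -, hxt⟩ := T.coord_mem x
      refine ⟨t, ht, fun v hv => ?_, hxt⟩
      by_contra hvt
      exact (hx v hv).ne' (hxt.2.1 v hvt)
  rw [this]
  exact isOpen_biInter_finset fun v _ => isOpen_lt continuous_const (T.continuous_coord_apply v)

/-- The realization of K¹ is a space triangulated by `sd T.K` with empty subcomplex. The
second-subdivision star is the preimage, under the continuous map `sdCoord`, of a first-subdivision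
star there. -/
theorem isOpen_star₂ {C : Finset (Finset (Finset V))} (hC : C ∈ sd (sd T.K)) :
    IsOpen (T.cellStar (sd (sd T.K)) cell₂ C) := by
  let P : SimplicialPair (Finset V) := ⟨sd T.K, ⊥, bot_le⟩
  let T' : Triangulation P.space (Finset V) := { P with homeo := Homeomorph.refl _ }
  have hmem : ∀ x, T.sdCoord x ∈ P.space := fun x => by
    obtain ⟨c, hc, hf, -⟩ := T.sdCoord_spec x
    exact ⟨c, hc, fun h => h, hf⟩
  have hcont : Continuous fun x => (⟨T.sdCoord x, hmem x⟩ : P.space) :=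
    (continuous_pi T.continuous_sdCoord_apply).subtype_mk hmem
  convert (T'.isOpen_star₁ (e := C) hC).preimage hcont using 1
  ext x
  obtain ⟨c, hc, hf, hx⟩ := T.sdCoord_spec x
  constructor
  · rintro ⟨D, hD, hCD, _, ⟨g, hg, rfl⟩, h⟩
    refine ⟨D, hD, hCD, g, hg, ?_⟩
    obtain ⟨d, hd, htop⟩ := exists_top hD
    exact sdMap_inj (hD.2.1 d hd) hc (sdMap_mem_openSimplex hD hd htop hg) hf (h.trans hx.symm)
  · rintro ⟨D, hD, hCD, h⟩
    exact ⟨D, hD, hCD, _, h, hx⟩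

theorem starConvex_cellStar {I : Type w} {J : PreAbstractSimplicialComplex I}
    {cell : Finset I → Set (V → ℝ)} {c : Finset I} (hc : c ∈ J)
    (hconv : ∀ d ∈ J, c ⊆ d → ∀ x ∈ cell c, ∀ y ∈ cell d, ∀ a b : ℝ, 0 ≤ a → 0 < b → a + b = 1 →
      a • x + b • y ∈ cell d)
    (hspace : ∀ d ∈ J, c ⊆ d → cell d ⊆ T.space) {x : X} (hx : T.coord x ∈ cell c) :
    StarConvex ℝ (T.coord x) (T.coord '' T.cellStar J cell c) := by
  rintro _ ⟨y, ⟨d, hd, hcd, hy⟩, rfl⟩ a b ha hb hab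
  -- At `b = 0` the point is the centre, which lies in the cell of `c` and not necessarily in that
  -- of `d`.
  rcases hb.eq_or_lt with rfl | hb
  · refine ⟨x, ⟨c, hc, subset_rfl, hx⟩, ?_⟩
    rw [show a = 1 by linarith]
    simp
  · have h1 := hconv d hd hcd _ hx _ hy a b ha hb hab
    exact ⟨T.homeo ⟨_, hspace d hd hcd h1⟩, ⟨d, hd, hcd, by rwa [T.coord_homeo]⟩, T.coord_homeo _⟩

theorem isBasicAt_star {s : Finset V} (hs : s ∈ T.K) (hs₀ : s ∉ T.K₀) :
    T.IsBasicAt T.K openSimplex s ⟨T.cellStar T.K openSimplex s, T.isOpen_star s⟩ := by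
  obtain ⟨z, hz⟩ := openSimplex_nonempty (mem_nonempty hs)
  have hx : T.coord (T.homeo ⟨z, s, hs, hs₀, hz⟩) ∈ openSimplex s := by rwa [T.coord_homeo]
  refine ⟨hs, fun y hy => hy, T.homeo ⟨z, s, hs, hs₀, hz⟩, ⟨s, hs, subset_rfl, hx⟩, hx, ?_⟩
  refine T.starConvex_cellStar hs
    (fun d _ hsd x hx y hy a b ha hb hab => convex_openSimplex hsd hx hy ha hb hab)
    (fun d hd hsd x hx => ⟨d, hd, fun h => hs₀ ?_, hx⟩) hx
  exact (T.K₀.isRelLowerSet_faces h).2 hsd (mem_nonempty hs)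

end Triangulation

/-! ### The lowest simplex of a simplex of the second subdivision -/

section Lowest
variable {V : Type v} {K K₀ : PreAbstractSimplicialComplex V} {C D : Finset (Finset (Finset V))}

/-- The least member of the least chain of a simplex of the second subdivision. -/
noncomputable def lowest (C : Finset (Finset (Finset V))) : Finset V :=
  dilationVertex (dilationVertex C)

theorem dilationVertex_mem_of_mem_sd {c : Finset (Finset V)} (hc : c ∈ sd K) :
    dilationVertex c ∈ c :=
  (dilationVertex_mem hc.1 hc.2.2).1

theorem dilationVertex_subset {c : Finset (Finset V)} (hc : c ∈ sd K) {σ : Finset V}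
    (hσ : σ ∈ c) : dilationVertex c ⊆ σ :=
  (dilationVertex_mem hc.1 hc.2.2).2 σ hσ

theorem dilationVertex_mem_sd (hC : C ∈ sd (sd K)) : dilationVertex C ∈ sd K :=
  hC.2.1 _ (dilationVertex_mem_of_mem_sd hC)

theorem lowest_mem_dilationVertex (hC : C ∈ sd (sd K)) : lowest C ∈ dilationVertex C :=
  dilationVertex_mem_of_mem_sd (dilationVertex_mem_sd hC)

theorem lowest_mem (hC : C ∈ sd (sd K)) : lowest C ∈ K :=
  (dilationVertex_mem_sd hC).2.1 _ (lowest_mem_dilationVertex hC)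

/-- A larger chain has a smaller least member. So among the chains in `C` the least one has the
largest least member, and `lowest C` is the top of the chain Σ(C). -/
theorem dilationVertex_subset_lowest (hC : C ∈ sd (sd K)) {c : Finset (Finset V)} (hc : c ∈ C) :
    dilationVertex c ⊆ lowest C :=
  dilationVertex_subset (hC.2.1 c hc) (dilationVertex_subset hC hc (lowest_mem_dilationVertex hC))

theorem lowest_mono (hC : C ∈ sd (sd K)) (hD : D ∈ sd (sd K)) (h : C ⊆ D) :
    lowest C ⊆ lowest D :=
  dilationVertex_subset_lowest hD (h (dilationVertex_mem_of_mem_sd hC))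

theorem lowest_mem_dilation (hC : C ∈ sd (sd K)) : lowest C ∈ dilation C := by
  classical
  exact Finset.mem_image_of_mem _ (dilationVertex_mem_of_mem_sd hC)

theorem subset_lowest_of_mem_dilation (hC : C ∈ sd (sd K)) {σ : Finset V} (hσ : σ ∈ dilation C) :
    σ ⊆ lowest C := by
  classical
  obtain ⟨c, hc, rfl⟩ := Finset.mem_image.1 hσ
  exact dilationVertex_subset_lowest hC hc

theorem dilation_notMem_sd (hC : C ∈ sd (sd K)) :
    dilation C ∉ sd K₀ ↔ lowest C ∉ K₀ := by
  refine not_congr ⟨fun h => h.2.1 _ (lowest_mem_dilation hC), fun h => ?_⟩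
  have hd := dilation_mem hC
  exact ⟨hd.1, fun σ hσ => (K₀.isRelLowerSet_faces h).2 (subset_lowest_of_mem_dilation hC hσ)
    (mem_nonempty (hd.2.1 σ hσ)), hd.2.2⟩

/-- A simplex of the second subdivision lies outside the closed star of the subcomplex `K₀` if and
only if its lowest simplex is not in `K₀`. -/
theorem notMem_closedStar (hC : C ∈ sd (sd K)) :
    C ∉ closedStar (sd (sd K)) (sd (sd K₀)) ↔ lowest C ∉ K₀ := by
  classical
  refine not_congr ⟨?_, fun h => ?_⟩
  · rintro ⟨-, D, hD, hCD, R, hR, hRD⟩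
    obtain ⟨r, hr⟩ := hR.1
    have h0 := hR.2.1 r hr
    have h1 := lowest_mono hC hD hCD
    -- The least chain of `D` is contained in `r`, a chain of simplices of `K₀`; so `lowest D` is in
    -- `K₀`.
    have h2 := dilationVertex_subset hD (hRD hr) (lowest_mem_dilationVertex hD)
    exact (K₀.isRelLowerSet_faces (h0.2.1 _ h2)).2 h1 (mem_nonempty (lowest_mem hC))
  · have h1 : ({lowest C} : Finset (Finset V)) ∈ sd K₀ :=
      ⟨Finset.singleton_nonempty _, by simpa using h, by simp⟩
    have h2 : ({lowest C} : Finset (Finset V)) ∈ sd K :=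
      ⟨Finset.singleton_nonempty _, by simpa using lowest_mem hC, by simp⟩
    -- The one-member chain `{lowest C}` lies in the least chain of `C`, hence in all of them.
    -- Adding it to `C` gives a simplex with the vertex `{lowest C}` in the second subdivision of
    -- `K₀`.
    refine ⟨hC, insert {lowest C} C, ⟨Finset.insert_nonempty _ _, ?_, ?_⟩,
      Finset.subset_insert _ _, {{lowest C}}, ⟨Finset.singleton_nonempty _, ?_, by simp⟩, by simp⟩
    · intro c hc
      rcases Finset.mem_insert.1 hc with rfl | hc
      exacts [h2, hC.2.1 c hc]
    · rw [Finset.coe_insert]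
      refine hC.2.2.insert fun c hc _ => Or.inl (Finset.singleton_subset_iff.2 ?_)
      exact dilationVertex_subset hC hc (lowest_mem_dilationVertex hC)
    · simpa using h1

theorem lowest_push {W : Type v'} {f : W → V} {K : PreAbstractSimplicialComplex W}
    {D : Finset (Finset (Finset W))} (hD : D ∈ sd (sd K)) :
    lowest (push (push (push f)) D) = push f (lowest D) := by
  rw [lowest, dilationVertex_push hD, dilationVertex_push (dilationVertex_mem_sd hD), lowest]

theorem singleton_mem_sd {σ : Finset V} (hσ : σ ∈ K) : {σ} ∈ sd K :=
  ⟨Finset.singleton_nonempty _, by simpa using hσ, by simp⟩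

theorem pair_mem_sd [DecidableEq (Finset V)] {σ τ : Finset V} (hσ : σ ∈ K) (hτ : τ ∈ K)
    (h : σ ⊆ τ) : {σ, τ} ∈ sd K := by
  refine ⟨Finset.insert_nonempty _ _, ?_, ?_⟩
  · simp [hσ, hτ]
  · simpa using IsChain.pair h

theorem dilationVertex_singleton (σ : Finset V) : dilationVertex {σ} = σ :=
  dilationVertex_eq (by simp) (by simp) (by simp)

theorem dilationVertex_pair [DecidableEq (Finset V)] {σ τ : Finset V} (h : σ ⊆ τ) :
    dilationVertex {σ, τ} = σ :=
  dilationVertex_eq (by simpa using IsChain.pair h) (by simp) (by simpa using h)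

end Lowest

/-! ### Stars of the subdivisions as basic open sets of K -/

namespace Triangulation
variable {X : Type u} [TopologicalSpace X] {V : Type v} (T : Triangulation X V)

/-- A cell of K¹ lies in the open simplex of the top of its chain, and enlarging a chain enlarges
its top. This lets constructibility with respect to K apply to the values F(st Σ(C)). -/
theorem isBasicAt_star₁ {e : Finset (Finset V)} (he : e ∈ sd T.K) (he₀ : e ∉ sd T.K₀)
    {σ : Finset V} (hσ : σ ∈ e) (htop : ∀ τ ∈ e, τ ⊆ σ) :
    T.IsBasicAt T.K openSimplex σ ⟨T.star₁ e, T.isOpen_star₁ he⟩ := by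
  obtain ⟨z, hz⟩ := cell₁_nonempty he.1
  have hzs := T.mem_space_of_mem_cell₁ he he₀ hz
  have hx : T.coord (T.homeo ⟨z, hzs⟩) ∈ cell₁ e := by rwa [T.coord_homeo]
  refine ⟨he.2.1 σ hσ, ?_, T.homeo ⟨z, hzs⟩, ⟨e, he, subset_rfl, hx⟩, ?_, ?_⟩
  · rintro y ⟨d, hd, hed, f, hf, hy⟩
    obtain ⟨τ, hτ, hτtop⟩ := exists_top hd
    exact ⟨τ, hd.2.1 τ hτ, hτtop σ (hed hσ), hy ▸ sdMap_mem_openSimplex hd hτ hτtop hf⟩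
  · obtain ⟨f, hf, hfx⟩ := hx
    exact hfx ▸ sdMap_mem_openSimplex he hσ htop hf
  · refine T.starConvex_cellStar he
      (fun d _ hed x hx y hy a b ha hb hab => convex_cell₁ hed hx hy ha hb hab)
      (fun d hd hed x hx => T.mem_space_of_mem_cell₁ hd (fun h => he₀ ?_) hx) hx
    exact ⟨he.1, fun τ hτ => h.2.1 τ (hed hτ), he.2.2⟩

theorem cell₂_subset_space {C : Finset (Finset (Finset V))} (hC : C ∈ sd (sd T.K))
    (hC₀ : lowest C ∉ T.K₀) : cell₂ C ⊆ T.space := by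
  obtain ⟨c, hc, htop, σ, hσ, htop', h⟩ := exists_carrier hC
  refine fun x hx => ⟨σ, (hC.2.1 c hc).2.1 σ hσ, fun hσ₀ => hC₀ ?_, h hx⟩
  exact (T.K₀.isRelLowerSet_faces hσ₀).2
    (htop' _ (htop _ (dilationVertex_mem_of_mem_sd hC) (lowest_mem_dilationVertex hC)))
    (mem_nonempty (lowest_mem hC))

theorem exists_cell₂ (x : X) : ∃ C ∈ sd (sd T.K), T.coord x ∈ cell₂ C := by
  obtain ⟨c, hc, f, hf, hx⟩ := T.exists_star₁ x
  obtain ⟨C, hC, hfC⟩ := exists_mem_cell₁ hc hf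
  exact ⟨C, hC, f, hfC, hx⟩

variable {T}

theorem IsBasicAt.isBasicAt_carrier {C : Finset (Finset (Finset V))} {U : Opens X}
    (h : T.IsBasicAt (sd (sd T.K)) cell₂ C U) {σ : Finset V} (hσ : cell₂ C ⊆ openSimplex σ) :
    T.IsBasicAt T.K openSimplex σ U := by
  obtain ⟨hC, hU, x, hxU, hx, hs⟩ := h
  obtain ⟨c, hc, -, τ, hτ, -, hCτ⟩ := exists_carrier hC
  obtain rfl := openSimplex_inj (hCτ hx) (hσ hx)
  refine ⟨(hC.2.1 c hc).2.1 τ hτ, fun y hy => ?_, x, hxU, hCτ hx, hs⟩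
  obtain ⟨D, hD, hCD, hyD⟩ := hU y hy
  obtain ⟨d, hd, htop, ρ, hρ, htop', hDρ⟩ := exists_carrier hD
  exact ⟨ρ, (hD.2.1 d hd).2.1 ρ hρ, htop' τ (htop c (hCD hc) hτ), hDρ hyD⟩

end Triangulation

/-! ### Geometry of constructible étale opens -/

namespace IsConstructibleEtale
variable {m : ℕ} {M : Type u} [TopologicalSpace M] {A : Type u'} [TopologicalSpace A]
  {V : Type v} {W : Type v'} {T : Triangulation M V} {a : A → M} {L : Triangulation A W}
  {ψ : W → V}

theorem push_mem (ha : IsConstructibleEtale m T a L ψ) {s : Finset W} (hs : s ∈ L.K) :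
    push ψ s ∈ T.K := ha.simplicial s hs

theorem coord_mem_push (ha : IsConstructibleEtale m T a L ψ) {s : Finset W} {x : A}
    (hx : L.coord x ∈ openSimplex s) : T.coord (a x) ∈ openSimplex (push ψ s) := by
  rw [ha.comm]
  exact linearExtension_mem_openSimplex hx

/-- An interior point of `s` is a point of A, so its image lies in M = |K - K₀|, and `push ψ s` is
the simplex that carries it. -/
theorem push_notMem (ha : IsConstructibleEtale m T a L ψ) {s : Finset W} (hs : s ∈ L.K)
    (hs₀ : s ∉ L.K₀) : push ψ s ∉ T.K₀ := by
  obtain ⟨z, hz⟩ := openSimplex_nonempty (mem_nonempty hs)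
  have hx : L.coord (L.homeo ⟨z, s, hs, hs₀, hz⟩) ∈ openSimplex s := by rwa [L.coord_homeo]
  obtain ⟨t, -, ht₀, h⟩ := T.coord_mem (a (L.homeo ⟨z, s, hs, hs₀, hz⟩))
  rwa [openSimplex_inj (ha.coord_mem_push hx) h]

theorem coord_add_smul (ha : IsConstructibleEtale m T a L ψ) {x y z : A} {b c : ℝ}
    (h : L.coord z = b • L.coord x + c • L.coord y) :
    T.coord (a z) = b • T.coord (a x) + c • T.coord (a y) := by
  classical
  obtain ⟨s, -, -, hs⟩ := L.coord_mem x
  obtain ⟨t, -, -, ht⟩ := L.coord_mem y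
  rw [ha.comm, ha.comm, ha.comm, h]
  exact linearExtension_add_smul (s := s ∪ t)
    (fun i hi => hs.2.1 i fun h => hi (Finset.mem_union_left _ h))
    (fun i hi => ht.2.1 i fun h => hi (Finset.mem_union_right _ h)) b c

theorem starConvex_image (ha : IsConstructibleEtale m T a L ψ) {S : Set A} {x : A}
    (h : StarConvex ℝ (L.coord x) (L.coord '' S)) :
    StarConvex ℝ (T.coord (a x)) (T.coord '' (a '' S)) := by
  rintro _ ⟨_, ⟨y, hy, rfl⟩, rfl⟩ b c hb hc hbc
  obtain ⟨z, hz, hzx⟩ := h ⟨y, hy, rfl⟩ hb hc hbc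
  exact ⟨_, ⟨z, hz, rfl⟩, ha.coord_add_smul hzx⟩

/-- The open star of a simplex is mapped injectively, since the étale open is injective near a point
of the simplex, and maps segments from this point to segments. -/
theorem injOn_star (ha : IsConstructibleEtale m T a L ψ) {s : Finset W} (hs : s ∈ L.K)
    (hs₀ : s ∉ L.K₀) : Set.InjOn a (L.cellStar L.K openSimplex s) := by
  obtain ⟨-, -, x, -, -, hstar⟩ := L.isBasicAt_star hs hs₀
  obtain ⟨e, hxe, rfl⟩ := ha.isLocalHomeomorph x
  -- `γ` runs along the segment from `x` towards `y`; outside `(0, 1]` its value is irrelevant.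
  have key : ∀ y ∈ L.cellStar L.K openSimplex s, ∃ γ : ℝ → A,
      (∀ ε ∈ Set.Ioc (0 : ℝ) 1, L.coord (γ ε) = (1 - ε) • L.coord x + ε • L.coord y) ∧
      Filter.Tendsto γ (nhdsWithin 0 (Set.Ioi 0)) (nhds x) := by
    intro y hy
    have hex : ∀ ε : ℝ, ∃ z, ε ∈ Set.Ioc (0 : ℝ) 1 →
        L.coord z = (1 - ε) • L.coord x + ε • L.coord y := by
      intro ε
      by_cases hε : ε ∈ Set.Ioc (0 : ℝ) 1
      · obtain ⟨z, -, hz⟩ := hstar ⟨y, hy, rfl⟩ (sub_nonneg.2 hε.2) hε.1.le (by ring)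
        exact ⟨z, fun _ => hz⟩
      · exact ⟨x, fun h => absurd h hε⟩
    choose γ hγ using hex
    refine ⟨γ, hγ, ?_⟩
    rw [L.isEmbedding_coord.isInducing.tendsto_nhds_iff]
    have hcont : Continuous fun ε : ℝ => (1 - ε) • L.coord x + ε • L.coord y := by fun_prop
    have h0 := hcont.tendsto 0
    simp only [sub_zero, one_smul, zero_smul, add_zero] at h0
    refine (h0.mono_left nhdsWithin_le_nhds).congr' ?_
    filter_upwards [Ioc_mem_nhdsGT (zero_lt_one' ℝ)] with ε hε
    exact (hγ ε hε).symm
  intro y hy y' hy' hyy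
  obtain ⟨γ, hγ, hγx⟩ := key y hy
  obtain ⟨γ', hγ', hγx'⟩ := key y' hy'
  have hO := e.open_source.mem_nhds hxe
  obtain ⟨ε, ⟨hε, h1⟩, h2⟩ := ((Filter.Eventually.and (Ioc_mem_nhdsGT (zero_lt_one' ℝ))
    (hγx.eventually hO)).and (hγx'.eventually hO)).exists
  -- For small `ε` both points lie where `a` is injective, and their images are the same point of
  -- the segment from `a x` to `a y = a y'`.
  have h3 : γ ε = γ' ε := by
    refine e.injOn h1 h2 (T.coord_injective ?_)
    rw [ha.coord_add_smul (hγ ε hε), ha.coord_add_smul (hγ' ε hε), hyy]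
  apply L.coord_injective
  have h4 := (hγ ε hε).symm.trans ((congrArg L.coord h3).trans (hγ' ε hε))
  exact smul_right_injective _ hε.1.ne' (add_left_cancel h4)

/-- If two vertices of `s` had the same image, shifting weight from one to the other would give two
points of the open simplex with equal images, against `injOn_star`. -/
theorem injOn_vertices (ha : IsConstructibleEtale m T a L ψ) {s : Finset W} (hs : s ∈ L.K)
    (hs₀ : s ∉ L.K₀) : Set.InjOn ψ (s : Set W) := by
  classical
  intro w hw w' hw' hψ
  by_contra hne
  -- Equal weights on `s` with the weight of `w` doubled; the total before normalization is `s.card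
  -- + 1`.
  let x : W → W → ℝ := fun w u => if u ∈ s then (1 + if u = w then 1 else 0) / (s.card + 1) else 0
  have hpos : (0 : ℝ) < s.card + 1 := by positivity
  have hx : ∀ w ∈ s, x w ∈ openSimplex s := by
    intro w hw
    refine ⟨fun u hu => ?_, fun u hu => if_neg hu, ?_⟩
    · simp only [x, if_pos hu]
      refine div_pos ?_ hpos
      split_ifs <;> norm_num
    · rw [Finset.sum_congr rfl fun u hu => if_pos hu, ← Finset.sum_div, Finset.sum_add_distrib,
        Finset.sum_ite_eq', if_pos hw]
      simp [hpos.ne']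
  have hmem : ∀ w (hw : w ∈ s), x w ∈ L.space := fun w hw => ⟨s, hs, hs₀, hx w hw⟩
  have hstar : ∀ w (hw : w ∈ s), L.homeo ⟨x w, hmem w hw⟩ ∈ L.cellStar L.K openSimplex s :=
    fun w hw => ⟨s, hs, subset_rfl, by rw [L.coord_homeo]; exact hx w hw⟩
  have hlin : ∀ w ∈ s, ∀ v, linearExtension ψ (x w) v =
      (∑ u ∈ s, if ψ u = v then (1 : ℝ) / (s.card + 1) else 0) +
        if ψ w = v then (1 : ℝ) / (s.card + 1) else 0 := by
    intro w hw v
    rw [linearExtension_apply (hx w hw).2.1]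
    have : (if ψ w = v then (1 : ℝ) / (s.card + 1) else 0) =
        ∑ u ∈ s, if u = w then (if ψ u = v then (1 : ℝ) / (s.card + 1) else 0) else 0 := by
      rw [Finset.sum_ite_eq', if_pos hw]
    rw [this, ← Finset.sum_add_distrib]
    refine Finset.sum_congr rfl fun u hu => ?_
    simp only [x, if_pos hu]
    split_ifs <;> ring
  have heq : L.homeo ⟨x w, hmem w hw⟩ = L.homeo ⟨x w', hmem w' hw'⟩ := by
    refine ha.injOn_star hs hs₀ (hstar w hw) (hstar w' hw') (T.coord_injective ?_)
    rw [ha.comm, ha.comm, L.coord_homeo, L.coord_homeo]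
    funext v
    rw [hlin w hw, hlin w' hw', hψ]
  have h1 : x w = x w' := congrArg Subtype.val (L.homeo.injective heq)
  have h2 := congrFun h1 w
  simp only [x, if_pos (Finset.mem_coe.1 hw), if_neg hne, if_true, add_zero] at h2
  rw [div_left_inj' hpos.ne'] at h2
  norm_num at h2

theorem isPreconnected_of_image (ha : IsConstructibleEtale m T a L ψ) {U : Opens A}
    (hinj : Set.InjOn a U) (h : IsPreconnected (a '' U)) : IsPreconnected (U : Set A) := by
  have hopen : IsOpenMap fun x : U => a x :=
    ha.isLocalHomeomorph.isOpenMap.comp U.2.isOpenMap_subtype_val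
  have h1 := h.preimage_of_isOpenMap (f := fun x : U => a x)
    (fun x y hxy => Subtype.ext (hinj x.2 y.2 hxy)) hopen
    (by rintro _ ⟨x, hx, rfl⟩; exact ⟨⟨x, hx⟩, rfl⟩)
  have h2 := h1.image Subtype.val continuous_subtype_val.continuousOn
  convert h2 using 1
  ext x
  constructor
  · exact fun hx => ⟨⟨x, hx⟩, ⟨x, hx, rfl⟩, rfl⟩
  · rintro ⟨y, -, rfl⟩
    exact y.2

/-- An open set that is mapped injectively onto a basic open set lies in the open star of the simplex
with which it is associated. -/
theorem subset_star (ha : IsConstructibleEtale m T a L ψ) {U : Opens A} (hinj : Set.InjOn a U)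
    {s : Finset W} {x : A} (hxU : x ∈ U) (hx : L.coord x ∈ openSimplex s)
    (hU : T.IsBasicAt T.K openSimplex (push ψ s) ⟨a '' U, ha.isLocalHomeomorph.isOpenMap _ U.2⟩) :
    (U : Set A) ⊆ L.cellStar L.K openSimplex s := by
  have hconn : IsPreconnected (U : Set A) :=
    ha.isPreconnected_of_image hinj
      (Triangulation.IsBasic.isConnected (T := T) ⟨_, hU⟩).isPreconnected
  intro y hy
  obtain ⟨t, ht, ht₀, hyt⟩ := L.coord_mem y
  refine ⟨t, ht, fun w hw => ?_, hyt⟩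
  by_contra hwt
  -- `O₁` and `O₂` are open and cover `U`, since `ψ w` is a vertex of the carrier of every point of
  -- `a '' U`. They are disjoint because `ψ` is injective on each simplex of L - L₀. As `U` is
  -- connected and meets `O₁` at `x`, it cannot meet `O₂`, which would contain `y`.
  let O₁ : Set A := {z | 0 < L.coord z w}
  let O₂ : Set A := {z | ∃ w', w' ≠ w ∧ ψ w' = ψ w ∧ 0 < L.coord z w'}
  have hO₁ : IsOpen O₁ := isOpen_lt continuous_const (L.continuous_coord_apply w)
  have hO₂ : IsOpen O₂ := by
    have : O₂ = ⋃ w' ∈ {w' | w' ≠ w ∧ ψ w' = ψ w}, {z | 0 < L.coord z w'} := by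
      ext z
      simp [O₂, and_assoc]
    rw [this]
    exact isOpen_biUnion fun w' _ => isOpen_lt continuous_const (L.continuous_coord_apply w')
  have hpos : ∀ {z : A} {r : Finset W}, L.coord z ∈ openSimplex r → ∀ {i}, 0 < L.coord z i →
      i ∈ r := by
    intro z r hz i hi
    by_contra hir
    exact hi.ne' (hz.2.1 i hir)
  have hcover : ∀ z ∈ U, ∃ w', ψ w' = ψ w ∧ 0 < L.coord z w' := by
    intro z hz
    obtain ⟨τ, -, hτ, hzτ⟩ := hU.2.1 (a z) ⟨z, hz, rfl⟩
    obtain ⟨r, -, -, hr⟩ := L.coord_mem z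
    rw [openSimplex_inj hzτ (ha.coord_mem_push hr)] at hτ
    obtain ⟨w', hw', h⟩ := mem_push.1 (hτ (mem_push_of_mem hw))
    exact ⟨w', h, hr.1 w' hw'⟩
  obtain ⟨z, -, hz₁, w', hne, hψ, hz₂⟩ := hconn O₁ O₂ hO₁ hO₂
    (fun z hz => by
      obtain ⟨w', h1, h2⟩ := hcover z hz
      by_cases hw' : w' = w
      · subst hw'
        exact Or.inl h2
      · exact Or.inr ⟨w', hw', h1, h2⟩)
    ⟨x, hxU, hx.1 w hw⟩
    (by
      obtain ⟨w', h1, h2⟩ := hcover y hy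
      exact ⟨y, hy, w', fun h => hwt (h ▸ hpos hyt h2), h1, h2⟩)
  obtain ⟨r, hr, hr₀, hzr⟩ := L.coord_mem z
  exact hne (ha.injOn_vertices hr hr₀ (hpos hzr hz₂) (hpos hzr hz₁) hψ)

theorem coord_mem_push₂ (ha : IsConstructibleEtale m T a L ψ) {D : Finset (Finset (Finset W))}
    (hD : D ∈ sd (sd L.K)) {x : A} (hx : L.coord x ∈ cell₂ D) :
    T.coord (a x) ∈ cell₂ (push (push (push ψ)) D) := by
  obtain ⟨s, hs, hs₀, hxs⟩ := L.coord_mem x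
  rw [ha.comm]
  exact linearExtension_mem_cell₂ (ha.injOn_vertices hs hs₀) hD hxs hx

theorem push_mem₂ (ha : IsConstructibleEtale m T a L ψ) {D : Finset (Finset (Finset W))}
    (hD : D ∈ sd (sd L.K)) : push (push (push ψ)) D ∈ sd (sd T.K) :=
  push_mem_sd (fun _ hc => push_mem_sd (fun _ hs => ha.push_mem hs) hc) hD

/-- The version of `subset_star` for the second subdivision. -/
theorem subset_star₂ (ha : IsConstructibleEtale m T a L ψ) {U : Opens A} (hinj : Set.InjOn a U)
    {D : Finset (Finset (Finset W))} (hD : D ∈ sd (sd L.K)) {x : A} (hxU : x ∈ U)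
    (hx : L.coord x ∈ cell₂ D)
    (hU : T.IsBasicAt (sd (sd T.K)) cell₂ (push (push (push ψ)) D)
      ⟨a '' U, ha.isLocalHomeomorph.isOpenMap _ U.2⟩) :
    (U : Set A) ⊆ L.cellStar (sd (sd L.K)) cell₂ D := by
  obtain ⟨s, hs, hs₀, hxs⟩ := L.coord_mem x
  have hxa := ha.coord_mem_push₂ hD hx
  have hcarrier : cell₂ (push (push (push ψ)) D) ⊆ openSimplex (push ψ s) := by
    obtain ⟨-, -, -, σ, -, -, h⟩ := exists_carrier (ha.push_mem₂ hD)
    rwa [openSimplex_inj (ha.coord_mem_push hxs) (h hxa)]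
  have hstar := ha.subset_star hinj hxU hxs (hU.isBasicAt_carrier hcarrier)
  intro y hy
  obtain ⟨t, ht, hst, hyt⟩ := hstar hy
  have ht₀ : t ∉ L.K₀ := by
    obtain ⟨t', -, h, hyt'⟩ := L.coord_mem y
    rwa [openSimplex_inj hyt hyt']
  obtain ⟨E, hE, hyE⟩ := L.exists_cell₂ y
  refine ⟨E, hE, ?_, hyE⟩
  obtain ⟨C, hC, hDC, hyC⟩ := hU.2.1 (a y) ⟨y, hy, rfl⟩
  rw [cell₂_inj hC (ha.push_mem₂ hE) hyC (ha.coord_mem_push₂ hE hyE)] at hDC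
  classical
  -- `D` and `E` are both built from faces of the single simplex `t`. Injectivity of `ψ` on `t`
  -- passes to faces and then to sets of faces, so the inclusion of the images in K² lifts to `D ⊆
  -- E`.
  have hDt : ∀ c ∈ D, ∀ σ ∈ c, σ ⊆ t := fun c hc σ hσ =>
    (subset_of_mem_cell₂ hD hx hxs hc hσ).trans hst
  have hEt : ∀ c ∈ E, ∀ σ ∈ c, σ ⊆ t := fun c hc σ hσ => subset_of_mem_cell₂ hE hyE hyt hc hσ
  have hinj₁ : Set.InjOn (push ψ) (t.powerset : Set (Finset W)) :=
    injOn_push (ha.injOn_vertices ht ht₀) fun σ hσ => Finset.mem_powerset.1 hσ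
  have hinj₂ : Set.InjOn (push (push ψ)) (t.powerset.powerset : Set (Finset (Finset W))) :=
    injOn_push hinj₁ fun c hc => Finset.mem_powerset.1 hc
  refine subset_of_push_subset hinj₂ ?_ ?_ hDC
  · exact fun c hc => Finset.mem_powerset.2 fun σ hσ => Finset.mem_powerset.2 (hDt c hc σ hσ)
  · exact fun c hc => Finset.mem_powerset.2 fun σ hσ => Finset.mem_powerset.2 (hEt c hc σ hσ)

theorem isBasicAt_image_star (ha : IsConstructibleEtale m T a L ψ) {s : Finset W} (hs : s ∈ L.K)
    (hs₀ : s ∉ L.K₀) : T.IsBasicAt T.K openSimplex (push ψ s)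
      ⟨a '' L.cellStar L.K openSimplex s, ha.isLocalHomeomorph.isOpenMap _ (L.isOpen_star s)⟩ := by
  obtain ⟨-, -, x, hxU, hx, hstar⟩ := L.isBasicAt_star hs hs₀
  refine ⟨ha.push_mem hs, ?_, a x, ⟨x, hxU, rfl⟩, ha.coord_mem_push hx, ha.starConvex_image hstar⟩
  rintro _ ⟨y, ⟨t, ht, hst, hy⟩, rfl⟩
  exact ⟨_, ha.push_mem ht, push_subset hst, ha.coord_mem_push hy⟩

theorem star₂_subset_shrinking {D : Finset (Finset (Finset W))} (hD : D ∈ sd (sd L.K))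
    (hD₀ : lowest D ∉ L.K₀) : L.cellStar (sd (sd L.K)) cell₂ D ⊆ L.shrinking := by
  rintro x ⟨E, hE, hDE, hx⟩
  refine ⟨E, hE, (notMem_closedStar hE).2 fun h => hD₀ ?_, hx⟩
  exact (L.K₀.isRelLowerSet_faces h).2 (lowest_mono hD hE hDE) (mem_nonempty (lowest_mem hD))

theorem injOn_star₂ (ha : IsConstructibleEtale m T a L ψ) {D : Finset (Finset (Finset W))}
    (hD : D ∈ sd (sd L.K)) (hD₀ : lowest D ∉ L.K₀) :
    Set.InjOn a (L.cellStar (sd (sd L.K)) cell₂ D) := by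
  refine (ha.injOn_star (lowest_mem hD) hD₀).mono ?_
  rintro x ⟨E, hE, hDE, hx⟩
  obtain ⟨e, he, htop, σ, hσ, htop', h⟩ := exists_carrier hE
  exact ⟨σ, (hE.2.1 e he).2.1 σ hσ, htop' _ (htop _ (hDE (dilationVertex_mem_of_mem_sd hD))
    (lowest_mem_dilationVertex hD)), h hx⟩

theorem isBasicAt_image_star₂ (ha : IsConstructibleEtale m T a L ψ)
    {D : Finset (Finset (Finset W))} (hD : D ∈ sd (sd L.K)) (hD₀ : lowest D ∉ L.K₀) :
    T.IsBasicAt (sd (sd T.K)) cell₂ (push (push (push ψ)) D)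
      ⟨a '' L.cellStar (sd (sd L.K)) cell₂ D,
        ha.isLocalHomeomorph.isOpenMap _ (L.isOpen_star₂ hD)⟩ := by
  obtain ⟨z, hz⟩ := cell₂_nonempty hD.1
  have hzs := L.cell₂_subset_space hD hD₀ hz
  have hx : L.coord (L.homeo ⟨z, hzs⟩) ∈ cell₂ D := by rwa [L.coord_homeo]
  refine ⟨ha.push_mem₂ hD, ?_, a (L.homeo ⟨z, hzs⟩), ⟨_, ⟨D, hD, subset_rfl, hx⟩, rfl⟩,
    ha.coord_mem_push₂ hD hx, ha.starConvex_image ?_⟩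
  · rintro _ ⟨y, ⟨E, hE, hDE, hy⟩, rfl⟩
    exact ⟨_, ha.push_mem₂ hE, push_subset hDE, ha.coord_mem_push₂ hE hy⟩
  · refine L.starConvex_cellStar hD
      (fun E hE hDE x hx y hy b c hb hc hbc => convex_cell₂ hE hDE hx hy hb hc hbc)
      (fun E hE hDE => L.cell₂_subset_space hE fun h => hD₀ ?_) hx
    exact (L.K₀.isRelLowerSet_faces h).2 (lowest_mono hD hE hDE) (mem_nonempty (lowest_mem hD))

end IsConstructibleEtale

/-! ### The posets of strata and the comparison of both bisheaves -/

/-- The simplices of `K - K₀`, ordered by reversed inclusion. -/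
abbrev SimplicialPair.Stratum {V : Type v} (P : SimplicialPair V) : Type v :=
  {s : Finset V // s ∈ P.K ∧ s ∉ P.K₀}ᵒᵈ

namespace Bisheaf
variable {X : Type u} [TopologicalSpace X] {V : Type v}

/-- Two ways of evaluating a constructible bisheaf agree if the open sets at which it is evaluated
are nested basic open sets associated to a common stratum. -/
theorem nonempty_pullbackIso (F : Bisheaf.{u, w} X) {T : Triangulation X V}
    (hF : F.IsConstructible T) {B : Type u'} [Preorder B] {B' : Type v'} [Preorder B']
    (g : B' →o ConnOpens X) (h : B →o ConnOpens X) (p : B' →o B) (hle : ∀ U, g U ≤ h (p U))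
    (hbasic : ∀ U, ∃ σ, T.IsBasicAt T.K openSimplex σ (g U).1 ∧
      T.IsBasicAt T.K openSimplex σ (h (p U)).1) :
    Nonempty (BisheafOn.PullbackIso (F.onConn.pullback g) (F.onConn.pullback h) p) := by
  have hiso : ∀ U, IsIso (F.sheaf.map (homOfLE (show (g U).1 ≤ (h (p U)).1 from hle U)).op) ∧
      IsIso (F.cosheaf.map (homOfLE (show (g U).1 ≤ (h (p U)).1 from hle U))) := by
    intro U
    obtain ⟨σ, h1, h2⟩ := hbasic U
    exact hF σ _ _ h1 h2 _
  have hsheaf : ∀ {P Q R S : Opens X} (i : Q ⟶ P) (j : S ⟶ Q) (k : R ⟶ P) (l : S ⟶ R),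
      F.sheaf.map i.op ≫ F.sheaf.map j.op = F.sheaf.map k.op ≫ F.sheaf.map l.op := by
    intro P Q R S i j k l
    rw [← F.sheaf.map_comp, ← F.sheaf.map_comp]
    rfl
  have hcosheaf : ∀ {P Q R S : Opens X} (i : P ⟶ Q) (j : Q ⟶ S) (k : P ⟶ R) (l : R ⟶ S),
      F.cosheaf.map i ≫ F.cosheaf.map j = F.cosheaf.map k ≫ F.cosheaf.map l := by
    intro P Q R S i j k l
    rw [← F.cosheaf.map_comp, ← F.cosheaf.map_comp]
    rfl
  -- Since `g U ⊆ h (p U)`, restriction leads from `h (p U)` to `g U` and extension back. The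
  -- required compatibility is the bisheaf axiom for this inclusion.
  refine ⟨{
    res :=
      { app := fun U => F.sheaf.map
          (homOfLE (show (g U.unop).1 ≤ (h (p U.unop)).1 from hle U.unop)).op
        naturality := fun U V f => ?_ }
    ext :=
      { app := fun U => F.cosheaf.map (homOfLE (show (g U).1 ≤ (h (p U)).1 from hle U))
        naturality := fun U V f => ?_ }
    res_bijective := fun U => ?_
    ext_bijective := fun U => ?_
    comm := fun U => F.comm (homOfLE (show (g U).1 ≤ (h (p U)).1 from hle U)) }⟩
  · exact hsheaf (homOfLE (h.monotone (p.monotone (leOfHom f.unop)))) (homOfLE (hle V.unop))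
      (homOfLE (hle U.unop)) (homOfLE (g.monotone (leOfHom f.unop)))
  · exact hcosheaf (homOfLE (g.monotone (leOfHom f))) (homOfLE (hle V))
      (homOfLE (hle U)) (homOfLE (h.monotone (p.monotone (leOfHom f))))
  · exact (ConcreteCategory.isIso_iff_bijective _).1 (hiso U.unop).1
  · exact (ConcreteCategory.isIso_iff_bijective _).1 (hiso U).2

end Bisheaf

namespace IsConstructibleEtale
variable {m : ℕ} {M : Type u} [TopologicalSpace M] {A : Type u'} [TopologicalSpace A]
  {V : Type v} {W : Type v'} {T : Triangulation M V} {a : A → M} {L : Triangulation A W}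
  {ψ : W → V}

/-- The open star of the image in `M` of a stratum of `A`. -/
def starMap (ha : IsConstructibleEtale m T a L ψ) : L.Stratum →o ConnOpens M where
  toFun s := ⟨⟨T.cellStar T.K openSimplex (push ψ (OrderDual.ofDual s).1), T.isOpen_star _⟩,
    Triangulation.IsBasic.isConnected
      ⟨_, T.isBasicAt_star (ha.push_mem s.2.1) (ha.push_notMem s.2.1 s.2.2)⟩⟩
  monotone' := by
    rintro s t hst x ⟨r, hr, hsr, hx⟩
    exact ⟨r, hr, (push_subset hst).trans hsr, hx⟩

/-- Take the point of `U` over the centre of `a '' U`; the simplex of L that carries it maps onto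
the simplex associated to the image. -/
theorem exists_stratum (ha : IsConstructibleEtale m T a L ψ)
    (U : EtaleBasic a ha.isLocalHomeomorph Set.univ T.IsBasic) :
    ∃ s : L.Stratum, T.IsBasicAt T.K openSimplex (push ψ (OrderDual.ofDual s).1)
      ⟨a '' U.1, ha.isLocalHomeomorph.isOpenMap _ U.1.2⟩ ∧
      ∃ x ∈ U.1, L.coord x ∈ openSimplex (OrderDual.ofDual s).1 := by
  obtain ⟨σ, hσ⟩ := U.2.2.2
  obtain ⟨-, -, _, ⟨x, hxU, rfl⟩, hx, -⟩ := id hσ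
  obtain ⟨s, hs, hs₀, hxs⟩ := L.coord_mem x
  obtain rfl := openSimplex_inj hx (ha.coord_mem_push hxs)
  exact ⟨OrderDual.toDual ⟨s, hs, hs₀⟩, hσ, x, hxU, hxs⟩

/-- `U` lies in the open star of `s`, hence so does the point of `U'` carried by `s'`. The case `U'
= U` gives uniqueness of the stratum. -/
theorem stratum_le (ha : IsConstructibleEtale m T a L ψ)
    {U' U : EtaleBasic a ha.isLocalHomeomorph Set.univ T.IsBasic} (h : U' ≤ U) {s' s : Finset W}
    (hs' : ∃ x ∈ U'.1, L.coord x ∈ openSimplex s')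
    (hs : T.IsBasicAt T.K openSimplex (push ψ s)
      ⟨a '' U.1, ha.isLocalHomeomorph.isOpenMap _ U.1.2⟩ ∧ ∃ x ∈ U.1, L.coord x ∈ openSimplex s) :
    s ⊆ s' := by
  obtain ⟨x', hxU', hx'⟩ := hs'
  obtain ⟨hU, x, hxU, hx⟩ := hs
  obtain ⟨t, -, hst, ht⟩ := ha.subset_star U.2.2.1 hxU hx hU (h hxU')
  rwa [openSimplex_inj hx' ht]

/-- The stratum with which a basic open set of `A` is associated. -/
noncomputable def stratum (ha : IsConstructibleEtale m T a L ψ) :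
    EtaleBasic a ha.isLocalHomeomorph Set.univ T.IsBasic →o L.Stratum where
  toFun U := (ha.exists_stratum U).choose
  monotone' U' U h := ha.stratum_le h (ha.exists_stratum U').choose_spec.2
    (ha.exists_stratum U).choose_spec

theorem stratum_eq (ha : IsConstructibleEtale m T a L ψ)
    (U : EtaleBasic a ha.isLocalHomeomorph Set.univ T.IsBasic) {s : L.Stratum}
    (hs : T.IsBasicAt T.K openSimplex (push ψ (OrderDual.ofDual s).1)
      ⟨a '' U.1, ha.isLocalHomeomorph.isOpenMap _ U.1.2⟩ ∧
      ∃ x ∈ U.1, L.coord x ∈ openSimplex (OrderDual.ofDual s).1) : ha.stratum U = s :=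
  Subtype.ext ((ha.stratum_le le_rfl hs.2 (ha.exists_stratum U).choose_spec).antisymm
    (ha.stratum_le le_rfl (ha.exists_stratum U).choose_spec.2 hs))

/-- The open star of a stratum of `A`. -/
def basicStar (ha : IsConstructibleEtale m T a L ψ) (s : L.Stratum) :
    EtaleBasic a ha.isLocalHomeomorph Set.univ T.IsBasic :=
  ⟨⟨L.cellStar L.K openSimplex (OrderDual.ofDual s).1, L.isOpen_star _⟩, Set.subset_univ _,
    ha.injOn_star s.2.1 s.2.2, _, ha.isBasicAt_image_star s.2.1 s.2.2⟩

theorem stratum_basicStar (ha : IsConstructibleEtale m T a L ψ) (s : L.Stratum) :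
    ha.stratum (ha.basicStar s) = s := by
  obtain ⟨-, -, x, hxU, hx, -⟩ := L.isBasicAt_star s.2.1 s.2.2
  exact ha.stratum_eq _ ⟨ha.isBasicAt_image_star s.2.1 s.2.2, x, hxU, hx⟩

theorem le_basicStar (ha : IsConstructibleEtale m T a L ψ)
    (U : EtaleBasic a ha.isLocalHomeomorph Set.univ T.IsBasic) :
    U ≤ ha.basicStar (ha.stratum U) := by
  obtain ⟨hU, x, hxU, hx⟩ := (ha.exists_stratum U).choose_spec
  exact ha.subset_star U.2.2.1 hxU hx hU

/-- The open star is the largest member of its fibre, and open stars form a monotone section of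
`stratum`. -/
theorem isConnectedQuotient_stratum (ha : IsConstructibleEtale m T a L ψ) :
    BisheafOn.IsConnectedQuotient ha.stratum where
  fibre x y hxy := by
    refine .trans _ (ha.basicStar (ha.stratum x)) _
      (.rel _ _ ⟨ha.le_basicStar x, (ha.stratum_basicStar _).symm⟩) (.symm _ _ (.rel _ _ ?_))
    rw [hxy]
    exact ⟨ha.le_basicStar y, (ha.stratum_basicStar _).symm⟩
  lift b c hbc := by
    refine ⟨ha.basicStar b, ha.basicStar c, ?_, ha.stratum_basicStar b, ha.stratum_basicStar c⟩
    rintro x ⟨r, hr, hbr, hx⟩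
    exact ⟨r, hr, Finset.Subset.trans hbc hbr, hx⟩

/-- The simplices of the second subdivision of `L` that lie in the shrinking. -/
abbrev ShrinkingStratum (L : Triangulation A W) : Type v' :=
  {D : Finset (Finset (Finset W)) // D ∈ sd (sd L.K) ∧ lowest D ∉ L.K₀}

/-- The point of `U` over the centre lies in the shrinking, which provides a cell `D` with lowest
simplex outside L₀. -/
theorem exists_shrinkingStratum (ha : IsConstructibleEtale m T a L ψ)
    (U : EtaleBasic a ha.isLocalHomeomorph L.shrinking T.IsDilationBasic) :
    ∃ D : ShrinkingStratum L, T.IsBasicAt (sd (sd T.K)) cell₂ (push (push (push ψ)) D.1)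
      ⟨a '' U.1, ha.isLocalHomeomorph.isOpenMap _ U.1.2⟩ ∧ ∃ x ∈ U.1, L.coord x ∈ cell₂ D.1 := by
  obtain ⟨C, -, hC⟩ := U.2.2.2
  obtain ⟨-, -, _, ⟨x, hxU, rfl⟩, hx, -⟩ := id hC
  obtain ⟨D, hD, hD₀, hxD⟩ := U.2.1 hxU
  obtain rfl := cell₂_inj hC.1 (ha.push_mem₂ hD) hx (ha.coord_mem_push₂ hD hxD)
  exact ⟨⟨D, hD, (notMem_closedStar hD).1 hD₀⟩, hC, x, hxU, hxD⟩

theorem shrinkingStratum_subset (ha : IsConstructibleEtale m T a L ψ)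
    {U' U : EtaleBasic a ha.isLocalHomeomorph L.shrinking T.IsDilationBasic} (h : U' ≤ U)
    {D' D : ShrinkingStratum L} (hD' : ∃ x ∈ U'.1, L.coord x ∈ cell₂ D'.1)
    (hD : T.IsBasicAt (sd (sd T.K)) cell₂ (push (push (push ψ)) D.1)
      ⟨a '' U.1, ha.isLocalHomeomorph.isOpenMap _ U.1.2⟩ ∧ ∃ x ∈ U.1, L.coord x ∈ cell₂ D.1) :
    D.1 ⊆ D'.1 := by
  obtain ⟨x', hxU', hx'⟩ := hD'
  obtain ⟨hU, x, hxU, hx⟩ := hD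
  obtain ⟨E, hE, hDE, hxE⟩ := ha.subset_star₂ U.2.2.1 D.2.1 hxU hx hU (h hxU')
  rwa [cell₂_inj D'.2.1 hE hx' hxE]

/-- The simplex of the second subdivision with which a basic open set is associated. -/
noncomputable def shrinkingStratum (ha : IsConstructibleEtale m T a L ψ)
    (U : EtaleBasic a ha.isLocalHomeomorph L.shrinking T.IsDilationBasic) : ShrinkingStratum L :=
  (ha.exists_shrinkingStratum U).choose

theorem shrinkingStratum_eq (ha : IsConstructibleEtale m T a L ψ)
    (U : EtaleBasic a ha.isLocalHomeomorph L.shrinking T.IsDilationBasic) {D : ShrinkingStratum L}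
    (hD : T.IsBasicAt (sd (sd T.K)) cell₂ (push (push (push ψ)) D.1)
      ⟨a '' U.1, ha.isLocalHomeomorph.isOpenMap _ U.1.2⟩ ∧ ∃ x ∈ U.1, L.coord x ∈ cell₂ D.1) :
    ha.shrinkingStratum U = D :=
  Subtype.ext ((ha.shrinkingStratum_subset le_rfl hD.2
    (ha.exists_shrinkingStratum U).choose_spec).antisymm
    (ha.shrinkingStratum_subset le_rfl (ha.exists_shrinkingStratum U).choose_spec.2 hD))

/-- The lowest simplex of the simplex of the second subdivision with which a basic open set is
associated. -/
noncomputable def lowestStratum (ha : IsConstructibleEtale m T a L ψ) :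
    EtaleBasic a ha.isLocalHomeomorph L.shrinking T.IsDilationBasic →o L.Stratum where
  toFun U := OrderDual.toDual ⟨lowest (ha.shrinkingStratum U).1,
    lowest_mem (ha.shrinkingStratum U).2.1, (ha.shrinkingStratum U).2.2⟩
  monotone' U' U h := lowest_mono (ha.shrinkingStratum U).2.1 (ha.shrinkingStratum U').2.1
    (ha.shrinkingStratum_subset h (ha.exists_shrinkingStratum U').choose_spec.2
      (ha.exists_shrinkingStratum U).choose_spec)

/-- The open star in the second subdivision. -/
def basicStar₂ (ha : IsConstructibleEtale m T a L ψ) (D : ShrinkingStratum L) :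
    EtaleBasic a ha.isLocalHomeomorph L.shrinking T.IsDilationBasic :=
  ⟨⟨L.cellStar (sd (sd L.K)) cell₂ D.1, L.isOpen_star₂ D.2.1⟩, star₂_subset_shrinking D.2.1 D.2.2,
    ha.injOn_star₂ D.2.1 D.2.2, _, by
      rw [dilation_notMem_sd (ha.push_mem₂ D.2.1), lowest_push D.2.1]
      exact ha.push_notMem (lowest_mem D.2.1) D.2.2, ha.isBasicAt_image_star₂ D.2.1 D.2.2⟩

theorem shrinkingStratum_basicStar₂ (ha : IsConstructibleEtale m T a L ψ)
    (D : ShrinkingStratum L) : ha.shrinkingStratum (ha.basicStar₂ D) = D := by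
  obtain ⟨z, hz⟩ := cell₂_nonempty D.2.1.1
  have hx : L.coord (L.homeo ⟨z, L.cell₂_subset_space D.2.1 D.2.2 hz⟩) ∈ cell₂ D.1 := by
    rwa [L.coord_homeo]
  exact ha.shrinkingStratum_eq _ ⟨ha.isBasicAt_image_star₂ D.2.1 D.2.2, _,
    ⟨D.1, D.2.1, subset_rfl, hx⟩, hx⟩

theorem lowestStratum_basicStar₂ (ha : IsConstructibleEtale m T a L ψ)
    (D : ShrinkingStratum L) : (OrderDual.ofDual (ha.lowestStratum (ha.basicStar₂ D))).1 =
      lowest D.1 :=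
  congrArg (fun D : ShrinkingStratum L => lowest D.1) (ha.shrinkingStratum_basicStar₂ D)

theorem basicStar₂_le (ha : IsConstructibleEtale m T a L ψ) {D E : ShrinkingStratum L}
    (h : D.1 ⊆ E.1) : ha.basicStar₂ E ≤ ha.basicStar₂ D := by
  rintro x ⟨r, hr, hEr, hx⟩
  exact ⟨r, hr, h.trans hEr, hx⟩

theorem le_basicStar₂ (ha : IsConstructibleEtale m T a L ψ)
    (U : EtaleBasic a ha.isLocalHomeomorph L.shrinking T.IsDilationBasic) :
    U ≤ ha.basicStar₂ (ha.shrinkingStratum U) := by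
  obtain ⟨hU, x, hxU, hx⟩ := (ha.exists_shrinkingStratum U).choose_spec
  exact ha.subset_star₂ U.2.2.1 (ha.shrinkingStratum U).2.1 hxU hx hU

open Classical in
/-- A basic open set is linked, within its fibre, to the open star of the barycenter of its lowest
simplex. -/
theorem eqvGen_basicStar₂ (ha : IsConstructibleEtale m T a L ψ)
    (U : EtaleBasic a ha.isLocalHomeomorph L.shrinking T.IsDilationBasic) {D : ShrinkingStratum L}
    (hD : D.1 = {{(OrderDual.ofDual (ha.lowestStratum U)).1}}) :
    Relation.EqvGen (fun x y => x ≤ y ∧ ha.lowestStratum x = ha.lowestStratum y) U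
      (ha.basicStar₂ D) := by
  obtain ⟨E, hE⟩ : ∃ E, ha.shrinkingStratum U = E := ⟨_, rfl⟩
  have hlow : (OrderDual.ofDual (ha.lowestStratum U)).1 = lowest E.1 :=
    congrArg (fun D : ShrinkingStratum L => lowest D.1) hE
  rw [hlow] at hD
  have hc := dilationVertex_mem_sd E.2.1
  have hs : {lowest E.1} ∈ sd L.K := singleton_mem_sd (lowest_mem E.2.1)
  have hsc : {lowest E.1} ⊆ dilationVertex E.1 :=
    Finset.singleton_subset_iff.2 (lowest_mem_dilationVertex E.2.1)
  have e₁ : lowest {dilationVertex E.1} = lowest E.1 := by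
    rw [lowest, dilationVertex_singleton, lowest]
  have e₂ : lowest {{lowest E.1}, dilationVertex E.1} = lowest E.1 := by
    rw [lowest, dilationVertex_pair hsc, dilationVertex_singleton]
  let E₁ : ShrinkingStratum L := ⟨{dilationVertex E.1}, singleton_mem_sd hc, by
    rw [e₁]; exact E.2.2⟩
  -- With c the least chain of `E` and s its least member, the zigzag of faces is E ⊇ {c} ⊆ {{s}, c}
  -- ⊇ {{s}}. All four have lowest simplex s, and their open stars are ordered the opposite way.
  let E₂ : ShrinkingStratum L := ⟨{{lowest E.1}, dilationVertex E.1}, pair_mem_sd hs hc hsc, by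
    rw [e₂]; exact E.2.2⟩
  have h₁ : ha.lowestStratum (ha.basicStar₂ E₁) = ha.lowestStratum U :=
    Subtype.ext ((ha.lowestStratum_basicStar₂ E₁).trans (e₁.trans hlow.symm))
  have h₂ : ha.lowestStratum (ha.basicStar₂ E₂) = ha.lowestStratum U :=
    Subtype.ext ((ha.lowestStratum_basicStar₂ E₂).trans (e₂.trans hlow.symm))
  have hD' : ha.lowestStratum (ha.basicStar₂ D) = ha.lowestStratum U := by
    refine Subtype.ext (((ha.lowestStratum_basicStar₂ D).trans ?_).trans hlow.symm)
    rw [hD, lowest, dilationVertex_singleton, dilationVertex_singleton]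
  refine .trans _ (ha.basicStar₂ E₁) _ (.rel _ _ ⟨(ha.le_basicStar₂ U).trans ?_, h₁.symm⟩)
    (.trans _ (ha.basicStar₂ E₂) _ (.symm _ _ (.rel _ _ ⟨?_, h₂.trans h₁.symm⟩))
      (.rel _ _ ⟨?_, h₂.trans hD'.symm⟩))
  · rw [hE]
    exact ha.basicStar₂_le
      (Finset.singleton_subset_iff.2 (dilationVertex_mem_of_mem_sd E.2.1))
  · exact ha.basicStar₂_le (Finset.singleton_subset_iff.2 (by simp [E₂]))
  · refine ha.basicStar₂_le ?_
    rw [hD]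
    exact Finset.singleton_subset_iff.2 (by simp [E₂])

theorem isConnectedQuotient_lowestStratum (ha : IsConstructibleEtale m T a L ψ) :
    BisheafOn.IsConnectedQuotient ha.lowestStratum where
  fibre x y hxy := by
    let s := ha.lowestStratum x
    let D : ShrinkingStratum L := ⟨{{(OrderDual.ofDual s).1}},
      singleton_mem_sd (singleton_mem_sd s.2.1), by
        rw [lowest, dilationVertex_singleton, dilationVertex_singleton]
        exact s.2.2⟩
    exact .trans _ (ha.basicStar₂ D) _ (ha.eqvGen_basicStar₂ x rfl)
      (.symm _ _ (ha.eqvGen_basicStar₂ y (by rw [← hxy])))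
  lift b c hbc := by
    classical
    obtain ⟨t, ht, ht₀⟩ := b
    obtain ⟨s, hs, hs₀⟩ := c
    have hst : s ⊆ t := hbc
    have hp : {s, t} ∈ sd L.K := pair_mem_sd hs ht hst
    have htp : {t} ⊆ ({s, t} : Finset (Finset W)) := by simp
    have e₁ : lowest {{s, t}} = s := by
      rw [lowest, dilationVertex_singleton, dilationVertex_pair hst]
    have e₂ : lowest {{t}, {s, t}} = t := by
      rw [lowest, dilationVertex_pair htp, dilationVertex_singleton]
    -- Enlarging `{{s, t}}` by the smaller chain `{t}` raises the lowest simplex from `s` to `t`, so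
    -- the nested open stars of `E` and `D` lift the given pair.
    let D : ShrinkingStratum L := ⟨{{s, t}}, singleton_mem_sd hp, by rwa [e₁]⟩
    let E : ShrinkingStratum L :=
      ⟨{{t}, {s, t}}, pair_mem_sd (singleton_mem_sd ht) hp htp, by rwa [e₂]⟩
    refine ⟨ha.basicStar₂ E, ha.basicStar₂ D, ha.basicStar₂_le (by simp [D, E]), ?_, ?_⟩
    · exact Subtype.ext ((ha.lowestStratum_basicStar₂ E).trans e₂)
    · exact Subtype.ext ((ha.lowestStratum_basicStar₂ D).trans e₁)

/-- The images in `M` of the basic open sets of `A`. -/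
def imageMap (ha : IsConstructibleEtale m T a L ψ) :
    EtaleBasic a ha.isLocalHomeomorph Set.univ T.IsBasic →o ConnOpens M where
  toFun U := ⟨⟨a '' U.1, ha.isLocalHomeomorph.isOpenMap _ U.1.2⟩, U.2.2.2.isConnected⟩
  monotone' _ _ h := Set.image_mono h

/-- The dilations of the images in `M` of the basic open sets of the shrinking. -/
def dilateMap (ha : IsConstructibleEtale m T a L ψ) :
    EtaleBasic a ha.isLocalHomeomorph L.shrinking T.IsDilationBasic →o ConnOpens M where
  toFun U := ⟨⟨T.dilateSet (a '' U.1), U.2.2.2.isOpen⟩, U.2.2.2.isConnected⟩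
  monotone' _ _ h := Triangulation.dilateSet_mono (Set.image_mono h)

theorem nonempty_pullbackIso_stratum (ha : IsConstructibleEtale m T a L ψ) {F : Bisheaf.{u, w} M}
    (hF : F.IsConstructible T) :
    Nonempty (BisheafOn.PullbackIso
      ((F.onBasic T).etalePullback a ha.isLocalHomeomorph Set.univ)
      (F.onConn.pullback ha.starMap) ha.stratum) := by
  have hU := fun U => (ha.exists_stratum U).choose_spec.1
  exact F.nonempty_pullbackIso hF ha.imageMap ha.starMap ha.stratum (fun U => (hU U).2.1)
    fun U => ⟨_, hU U, T.isBasicAt_star (hU U).1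
      (ha.push_notMem (ha.stratum U).2.1 (ha.stratum U).2.2)⟩

/-- The dilation of the image is st Σ(C) with C the image of D. It is a basic open set of K at the
top of Σ(C), which is `lowest C = push ψ (lowest D)`, so constructibility compares it with the full
open star of that simplex. -/
theorem nonempty_pullbackIso_lowestStratum (ha : IsConstructibleEtale m T a L ψ)
    {F : Bisheaf.{u, w} M} (hF : F.IsConstructible T) :
    Nonempty (BisheafOn.PullbackIso
      ((F.dilate T).etalePullback a ha.isLocalHomeomorph L.shrinking)
      (F.onConn.pullback ha.starMap) ha.lowestStratum) := by
  have hU : ∀ U, T.IsBasicAt T.K openSimplex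
      (push ψ (OrderDual.ofDual (ha.lowestStratum U)).1) (ha.dilateMap U).1 := by
    intro U
    have h := (ha.exists_shrinkingStratum U).choose_spec.1
    have hD := (ha.shrinkingStratum U).2
    have hC := ha.push_mem₂ hD.1
    have e : (ha.dilateMap U).1 = ⟨T.star₁ (dilation (push (push (push ψ))
        (ha.shrinkingStratum U).1)), T.isOpen_star₁ (dilation_mem hC)⟩ :=
      Opens.ext (Triangulation.dilateSet_eq h)
    have hC₀ : dilation (push (push (push ψ)) (ha.shrinkingStratum U).1) ∉ sd T.K₀ := by
      rw [dilation_notMem_sd hC, lowest_push hD.1]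
      exact ha.push_notMem (lowest_mem hD.1) hD.2
    rw [e]
    refine T.isBasicAt_star₁ (dilation_mem hC) hC₀ ?_ ?_
    · change push ψ (lowest _) ∈ _
      rw [← lowest_push hD.1]
      exact lowest_mem_dilation hC
    · change ∀ τ ∈ _, τ ⊆ push ψ (lowest _)
      rw [← lowest_push hD.1]
      exact fun τ hτ => subset_lowest_of_mem_dilation hC hτ
  exact F.nonempty_pullbackIso hF ha.dilateMap ha.starMap ha.lowestStratum (fun U => (hU U).2.1)
    fun U => ⟨_, hU U, T.isBasicAt_star (hU U).1
      (ha.push_notMem (ha.lowestStratum U).2.1 (ha.lowestStratum U).2.2)⟩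

/-- For the coarse stratification `U` belongs to the simplex carrying the cell of D, the largest one
occurring in D; it contains `lowest D`, and the order on strata is reversed inclusion. -/
theorem stratum_le_lowestStratum (ha : IsConstructibleEtale m T a L ψ)
    (U : EtaleBasic a ha.isLocalHomeomorph L.shrinking T.IsDilationBasic) :
    ha.stratum (shrinkingMap T a ha.isLocalHomeomorph L U) ≤ ha.lowestStratum U := by
  obtain ⟨hU, x, hxU, hx⟩ := (ha.exists_shrinkingStratum U).choose_spec
  have hD := (ha.shrinkingStratum U).2
  obtain ⟨c, hc, htop, s, hs, htop', hsub⟩ := exists_carrier hD.1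
  have hC := ha.coord_mem_push₂ hD.1 hx
  have hcar : cell₂ (push (push (push ψ)) (ha.shrinkingStratum U).1) ⊆
      openSimplex (push ψ s) := by
    obtain ⟨-, -, -, σ, -, -, h⟩ := exists_carrier (ha.push_mem₂ hD.1)
    rwa [openSimplex_inj (ha.coord_mem_push (hsub hx)) (h hC)]
  have hle : lowest (ha.shrinkingStratum U).1 ⊆ s :=
    htop' _ (htop _ (dilationVertex_mem_of_mem_sd hD.1) (lowest_mem_dilationVertex hD.1))
  have hsK : s ∈ L.K ∧ s ∉ L.K₀ := ⟨(hD.1.2.1 c hc).2.1 s hs, fun h =>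
    hD.2 ((L.K₀.isRelLowerSet_faces h).2 hle (mem_nonempty (lowest_mem hD.1)))⟩
  rw [ha.stratum_eq (shrinkingMap T a ha.isLocalHomeomorph L U)
    (s := OrderDual.toDual ⟨s, hsK⟩) ⟨hU.isBasicAt_carrier hcar, x, hxU, hsub hx⟩]
  exact hle

end IsConstructibleEtale
end PersistentSheaf

/-- The persistent local system of `Iso(a^* F)`, restricted to the shrinking of the étale open `a`,
is isomorphic to the persistent local system of `Iso(ȧ^* Σ^* F)`, where `ȧ` is the shrinking. -/
theorem proposition8p4 {m : ℕ} {M : Type u} [TopologicalSpace M] [T2Space M]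
    [ChartedSpace (EuclideanSpace ℝ (Fin m)) M] {V : Type v}
    (T : PersistentSheaf.Triangulation M V)
    (F : PersistentSheaf.Bisheaf.{u, w} M) (hF : F.IsConstructible T)
    {A : Type u'} [TopologicalSpace A] [T2Space A] {W : Type v'} (a : A → M)
    (L : PersistentSheaf.Triangulation A W) (ψ : W → V)
    (ha : PersistentSheaf.IsConstructibleEtale m T a L ψ) :
    Nonempty
      ((((((F.onBasic T).etalePullback a ha.isLocalHomeomorph Set.univ).iso).pullback
          (PersistentSheaf.shrinkingMap T a ha.isLocalHomeomorph L)).image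
            ((PersistentSheaf.BisheafOn.isIsobisheaf_iso _).pullback _)).functor ≅
        (((((F.dilate T).etalePullback a ha.isLocalHomeomorph L.shrinking).iso).image
            (PersistentSheaf.BisheafOn.isIsobisheaf_iso _)).functor)) := by
  obtain ⟨c₁⟩ := ha.nonempty_pullbackIso_stratum hF
  obtain ⟨c₂⟩ := ha.nonempty_pullbackIso_lowestStratum hF
  let μ := PersistentSheaf.shrinkingMap T a ha.isLocalHomeomorph L
  let S := (F.onConn.pullback ha.starMap).iso.image
    (PersistentSheaf.BisheafOn.isIsobisheaf_iso _)
  let i₁ := Functor.isoWhiskerLeft μ.monotone.functor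
    (c₁.imageIso ha.isConnectedQuotient_stratum)
  -- The two maps to the strata are only comparable, so this step needs the local system `S`; the
  -- bisheaf on the strata need not be locally constant.
  let i₂ := S.isoOfLE (p := ha.stratum.comp μ) (q := ha.lowestStratum)
    ha.stratum_le_lowestStratum
  exact ⟨i₁ ≪≫ i₂ ≪≫ (c₂.imageIso ha.isConnectedQuotient_lowestStratum).symm⟩
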